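/- Presburger arithmetic is the first-order logic over the integers with atomic propositions $t\le 0$, where $t=a_0+\sum_i a_i x_i$ is a linear term with integer coefficients. A set $S\subseteq\mathbb Z^N$ is Presburger definable if $S=\{x\in\mathbb Z^N : x\models\psi\}$ for some Presburger formula $\psi$ with free variables among $x_1,\dots,x_N$. A finite monoid affine relation is a relation $R\subseteq\mathbb Z^N\times\mathbb Z^N$ presented as $$R(x,x')\iff x'=Ax+b\ \wedge\ \varphi(x),$$ where $A\in\mathbb Z^{N\times N}$ has a finite monoid of powers $\{A^i : i\ge 0\}$, $b\in\mathbb Z^N$, and $\varphi$ is a Presburger formula with free variables among $x_1,\dots,x_N$. A set $S\subseteq\mathbb Z^N$ is a non-termination precondition for $R$ if every $\nu\in S$ is the first element $\nu_0=\nu$ of an infinite sequence $(\nu_i)_{i\ge0}$ in $\mathbb Z^N$ with $(\nu_i,\nu_{i+1})\in R$ for all $i$. The weakest non-termination precondition $\mathrm{wnt}(R)$ is the union of all non-termination preconditions for $R$. The relation $R$ terminates (is well founded) if there is no infinite sequence $(\nu_i)_{i\ge0}$ in $\mathbb Z^N$ with $(\nu_i,\nu_{i+1})\in R$ for all $i$.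 **Theorem.** For every finite monoid affine relation $R$, the set $\mathrm{wnt}(R)$ is Presburger definable, and effectively so: there is a single total computable function which, given $(N,A,b,\varphi)$ presenting a finite monoid affine relation $R$, returns a Presburger formula with free variables among $x_1,\dots,x_N$ that defines $\mathrm{wnt}(R)$. Consequently, the termination problem is decidable for finite monoid affine relations: there is a total computable Boolean-valued function which, given $(N,A,b,\varphi)$ presenting a finite monoid affine relation $R$, returns true if and only if $R$ terminates. -/

import Mathlib

/-- Formulas of Presburger arithmetic, with variables `x 0, x 1, x 2, …` ranging over the integers:
first-order logic over the atomic propositions `c + a₀ * x 0 + … + aₖ * x k ≤ 0`, where `c` and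
`a = [a₀, …, aₖ]` are integers.  The remaining connectives and `∀` are the usual abbreviations. -/
inductive PForm : Type
  | atom (c : ℤ) (a : List ℤ) : PForm
  | not (φ : PForm) : PForm
  | and (φ ψ : PForm) : PForm
  | ex (i : ℕ) (φ : PForm) : PForm
  deriving DecidableEq

namespace PForm

/-- Truth of a formula under an assignment of integers to the variables. -/
def Realize : PForm → (ℕ → ℤ) → Prop
  | atom c a, v => c + ∑ i ∈ Finset.range a.length, a.getD i 0 * v i ≤ 0
  | not φ, v => ¬ φ.Realize v
  | and φ ψ, v => φ.Realize v ∧ ψ.Realize v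
  | ex i φ, v => ∃ z : ℤ, φ.Realize (Function.update v i z)

/-- The free variables of a formula. -/
def freeVars : PForm → Finset ℕ
  | atom _ a => (Finset.range a.length).filter fun i => a.getD i 0 ≠ 0
  | not φ => φ.freeVars
  | and φ ψ => φ.freeVars ∪ ψ.freeVars
  | ex i φ => φ.freeVars.erase i

/-- The Gödel numbering of formulas. -/
def toNat : PForm → ℕ
  | atom c a => 4 * Encodable.encode (c, a)
  | not φ => 4 * φ.toNat + 1
  | and φ ψ => 4 * Nat.pair φ.toNat ψ.toNat + 2
  | ex i φ => 4 * Nat.pair i φ.toNat + 3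

/-- The formula with a given Gödel number. -/
def ofNat (n : ℕ) : PForm :=
  if h0 : n % 4 = 0 then
    atom (Denumerable.ofNat (ℤ × List ℤ) (n / 4)).1 (Denumerable.ofNat (ℤ × List ℤ) (n / 4)).2
  else if h1 : n % 4 = 1 then
    have : n / 4 < n := by omega
    not (ofNat (n / 4))
  else if h2 : n % 4 = 2 then
    have : (n / 4).unpair.1 < n := (Nat.unpair_left_le _).trans_lt (by omega)
    have : (n / 4).unpair.2 < n := (Nat.unpair_right_le _).trans_lt (by omega)
    and (ofNat (n / 4).unpair.1) (ofNat (n / 4).unpair.2)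
  else
    have : (n / 4).unpair.2 < n := (Nat.unpair_right_le _).trans_lt (by omega)
    ex (n / 4).unpair.1 (ofNat (n / 4).unpair.2)
termination_by n

theorem ofNat_toNat (φ : PForm) : ofNat φ.toNat = φ := by
  induction φ with
  | atom c a =>
    rw [toNat, ofNat]
    simp only [Nat.mul_mod_right, ↓reduceDIte, Nat.mul_div_cancel_left _ (Nat.succ_pos 3),
      Denumerable.ofNat_encode]
  | not φ ih =>
    rw [toNat, ofNat]
    have h : (4 * φ.toNat + 1) / 4 = φ.toNat := by omega
    simp [Nat.add_mod, h, ih]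
  | and φ ψ ih₁ ih₂ =>
    rw [toNat, ofNat]
    have h : (4 * Nat.pair φ.toNat ψ.toNat + 2) / 4 = Nat.pair φ.toNat ψ.toNat := by omega
    simp [Nat.add_mod, h, ih₁, ih₂]
  | ex i φ ih =>
    rw [toNat, ofNat]
    have h : (4 * Nat.pair i φ.toNat + 3) / 4 = Nat.pair i φ.toNat := by omega
    simp [Nat.add_mod, h, ih]

theorem toNat_ofNat (n : ℕ) : (ofNat n).toNat = n := by
  induction n using Nat.strong_induction_on with
  | _ n ih =>
    rw [ofNat]
    split_ifs with h0 h1 h2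
    · simp only [toNat, Prod.mk.eta, Denumerable.encode_ofNat]
      omega
    · have := ih (n / 4) (by omega)
      simp only [toNat, this]
      omega
    · have e₁ := ih (n / 4).unpair.1 ((Nat.unpair_left_le _).trans_lt (by omega))
      have e₂ := ih (n / 4).unpair.2 ((Nat.unpair_right_le _).trans_lt (by omega))
      simp only [toNat, e₁, e₂, Nat.pair_unpair]
      omega
    · have e₂ := ih (n / 4).unpair.2 ((Nat.unpair_right_le _).trans_lt (by omega))
      simp only [toNat, e₂, Nat.pair_unpair]
      omega

/-- Formulas are coded by their Gödel numbers; this is what `Computable` refers to. -/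
instance : Denumerable PForm :=
  Denumerable.mk' ⟨toNat, ofNat, ofNat_toNat, toNat_ofNat⟩

/-- A valuation of `x 0, …, x (N - 1)`, extended (by zero) to all variables. -/
def extend {N : ℕ} (x : Fin N → ℤ) : ℕ → ℤ :=
  fun i => if h : i < N then x ⟨i, h⟩ else 0

/-- `φ.Sat x`: the valuation `x` of `x 0, …, x (N - 1)` satisfies `φ`, a formula whose free
variables are among these. -/
def Sat {N : ℕ} (φ : PForm) (x : Fin N → ℤ) : Prop :=
  φ.Realize (extend x)

/-- `φ` has free variables among `x 0, …, x (N - 1)` only, and defines the set `S`. -/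
def Defines {N : ℕ} (φ : PForm) (S : Set (Fin N → ℤ)) : Prop :=
  φ.freeVars ⊆ Finset.range N ∧ ∀ x, x ∈ S ↔ φ.Sat x

end PForm

/-- A set of integer vectors is Presburger definable. -/
def PresburgerDefinable {N : ℕ} (S : Set (Fin N → ℤ)) : Prop :=
  ∃ φ : PForm, φ.Defines S

/-- `S` is a non-termination precondition for `R`: every point of `S` starts an infinite
`R`-sequence. -/
def IsNonTermPrecondition {N : ℕ} (R : Set ((Fin N → ℤ) × (Fin N → ℤ)))
    (S : Set (Fin N → ℤ)) : Prop :=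
  ∀ ν ∈ S, ∃ s : ℕ → (Fin N → ℤ), s 0 = ν ∧ ∀ i, (s i, s (i + 1)) ∈ R

/-- The weakest non-termination precondition of `R`. -/
def wnt {N : ℕ} (R : Set ((Fin N → ℤ) × (Fin N → ℤ))) : Set (Fin N → ℤ) :=
  ⋃₀ {S | IsNonTermPrecondition R S}

/-- `R` terminates (universally), that is, it is well founded: there is no infinite
`R`-sequence. -/
def Terminating {N : ℕ} (R : Set ((Fin N → ℤ) × (Fin N → ℤ))) : Prop :=
  ¬ ∃ s : ℕ → (Fin N → ℤ), ∀ i, (s i, s (i + 1)) ∈ R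

/-- The data presenting an affine relation `x' = A x + b ∧ φ(x)`, where the guard `φ` is a
Presburger formula over the unprimed variables. -/
structure AffinePresentation (N : ℕ) where
  A : Matrix (Fin N) (Fin N) ℤ
  b : Fin N → ℤ
  guard : PForm
  guard_freeVars : guard.freeVars ⊆ Finset.range N

namespace AffinePresentation

variable {N : ℕ}

/-- The relation presented. -/
def rel (P : AffinePresentation N) : Set ((Fin N → ℤ) × (Fin N → ℤ)) :=
  {p | p.2 = P.A.mulVec p.1 + P.b ∧ P.guard.Sat p.1}

/-- The monoid of powers `{A ^ i | i ≥ 0}` is finite. -/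
def FiniteMonoid (P : AffinePresentation N) : Prop :=
  Finite (Submonoid.powers P.A)

/-- The input given to an algorithm: the dimension, the rows of `A`, the entries of `b`, and the
guard. -/
def code (P : AffinePresentation N) : ℕ × List (List ℤ) × List ℤ × PForm :=
  (N, List.ofFn fun i => List.ofFn (P.A i), List.ofFn P.b, P.guard)

end AffinePresentation

/-!
Let `T x = A x + b`. A point `x` lies in `wnt R` iff all `T^[n] x` satisfy the guard `φ`. If the
powers of `A` form a finite monoid, the minimal polynomial of `A` over `ℚ` divides some
`X ^ k * (X ^ r - 1)`, so it is a power of `X` times a product of distinct cyclotomic polynomials.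
Its degree is at most `N`, which bounds the exponent of `X` by `N`, and each cyclotomic `Φ_d` that
occurs has `φ(d) ≤ N`, hence `d ∣ (2 N)!`. Therefore `A ^ (N + (2 N)!) = A ^ N`
(`Matrix.pow_add_factorial_eq_of_finite_powers`). The preperiod `p = N` and the period `q = (2 N)!`
depend on `N` alone, so that no search for them is needed, and the algorithms below are total even
on input that presents no finite monoid affine relation.

After `p` steps, `q` further steps translate the orbit by the fixed vector
`c = T^[p + q] 0 - T^[p] 0`, so all iterates of `x` satisfy `φ` iff the first `p` do and, for all
`k ≥ 0`, the first `q` iterates of `T^[p] x + k c` do (`forall_iterate_iff`). This is a Presburger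
formula with the constant vector `c` (`PForm.wntFormula`). Instead of substituting into `φ`, it
evaluates `φ` under bound variables: `φ(T x)` is written as `∃ y, y = T x ∧ ∃ x, x = y ∧ φ(x)`, with
the inner quantifiers rebinding the variables of `φ`.

`R` terminates iff `wnt R` is empty, which is the truth of a Presburger sentence. It is decided by
quantifier elimination on disjunctive normal forms of inequalities and divisibilities. The truth of
a clause, as a function of one variable `z`, changes along an arithmetic progression whose
difference `D` is a common period of the divisibilities only next to the zero of an inequality
`a z + t ≤ 0`. So, if the clause can be satisfied, then it can be satisfied at some
`z = (j - t) / a` with `|j| ≤ |a| D`, or at some `z` with `|z| ≤ D` (`QE.Clause.exists_near`); these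
finitely many candidates are substituted after clearing denominators.

Both algorithms are primitive recursive.
-/

/-! ### Primitive recursive functions on integers, lists and formulas -/

-- The lemmas below are stated for composite functions, with functions of a bound variable
-- uncurried, so that `fun_prop` proves primitive recursiveness by following the definition. Boolean
-- `bif` is used in the computed functions, to keep decidability instances out of the way.
attribute [fun_prop] Primrec
attribute [fun_prop] Primrec.id Primrec.const Primrec.comp Primrec.pair

namespace Primrec

section

variable {α β γ σ : Type*} [Primcodable α] [Primcodable β] [Primcodable γ] [Primcodable σ]

@[fun_prop]
theorem fst' {f : α → β × γ} (hf : Primrec f) : Primrec fun a => (f a).1 := fst.comp hf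

@[fun_prop]
theorem snd' {f : α → β × γ} (hf : Primrec f) : Primrec fun a => (f a).2 := snd.comp hf

@[fun_prop]
theorem natAdd' {f g : α → ℕ} (hf : Primrec f) (hg : Primrec g) :
    Primrec fun a => f a + g a := nat_add.comp hf hg

@[fun_prop]
theorem natSub' {f g : α → ℕ} (hf : Primrec f) (hg : Primrec g) :
    Primrec fun a => f a - g a := nat_sub.comp hf hg

@[fun_prop]
theorem natMul' {f g : α → ℕ} (hf : Primrec f) (hg : Primrec g) :
    Primrec fun a => f a * g a := nat_mul.comp hf hg

@[fun_prop]
theorem natDiv' {f g : α → ℕ} (hf : Primrec f) (hg : Primrec g) :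
    Primrec fun a => f a / g a := nat_div.comp hf hg

@[fun_prop]
theorem natMod' {f g : α → ℕ} (hf : Primrec f) (hg : Primrec g) :
    Primrec fun a => f a % g a := nat_mod.comp hf hg

@[fun_prop]
theorem natMin' {f g : α → ℕ} (hf : Primrec f) (hg : Primrec g) :
    Primrec fun a => min (f a) (g a) := nat_min.comp hf hg

@[fun_prop]
theorem natMax' {f g : α → ℕ} (hf : Primrec f) (hg : Primrec g) :
    Primrec fun a => max (f a) (g a) := nat_max.comp hf hg

@[fun_prop]
theorem natPair' {f g : α → ℕ} (hf : Primrec f) (hg : Primrec g) :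
    Primrec fun a => Nat.pair (f a) (g a) := Primrec₂.natPair.comp hf hg

@[fun_prop]
theorem natUnpair' {f : α → ℕ} (hf : Primrec f) : Primrec fun a => (f a).unpair := unpair.comp hf

@[fun_prop]
theorem natBeq' {f g : α → ℕ} (hf : Primrec f) (hg : Primrec g) :
    Primrec fun a => f a == g a := Primrec.beq.comp hf hg

@[fun_prop]
theorem natBle' {f g : α → ℕ} (hf : Primrec f) (hg : Primrec g) :
    Primrec fun a => Nat.ble (f a) (g a) := by
  refine (nat_le.decide.comp hf hg).of_eq fun a => ?_
  rw [Bool.eq_iff_iff, Nat.ble_eq, decide_eq_true_iff]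

@[fun_prop]
theorem boolOr' {f g : α → Bool} (hf : Primrec f) (hg : Primrec g) :
    Primrec fun a => f a || g a := Primrec.or.comp hf hg

@[fun_prop]
theorem boolNot' {f : α → Bool} (hf : Primrec f) : Primrec fun a => !f a := Primrec.not.comp hf

@[fun_prop]
theorem cond' {c : α → Bool} {f g : α → σ} (hc : Primrec c) (hf : Primrec f) (hg : Primrec g) :
    Primrec fun a => bif c a then f a else g a := Primrec.cond hc hf hg

@[fun_prop]
theorem listMap' {f : α → List β} {g : α → β → σ} (hf : Primrec f)
    (hg : Primrec fun p : α × β => g p.1 p.2) : Primrec fun a => (f a).map (g a) :=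
  list_map hf hg

@[fun_prop]
theorem listFlatMap' {f : α → List β} {g : α → β → List σ} (hf : Primrec f)
    (hg : Primrec fun p : α × β => g p.1 p.2) : Primrec fun a => (f a).flatMap (g a) :=
  list_flatMap hf hg

@[fun_prop]
theorem listFoldr' {f : α → List β} {g : α → σ} {h : α → β → σ → σ} (hf : Primrec f)
    (hg : Primrec g) (hh : Primrec fun p : α × β × σ => h p.1 p.2.1 p.2.2) :
    Primrec fun a => (f a).foldr (h a) (g a) :=
  list_foldr (h := fun a p => h a p.1 p.2) hf hg hh

@[fun_prop]
theorem listAppend' {f g : α → List β} (hf : Primrec f) (hg : Primrec g) :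
    Primrec fun a => f a ++ g a := list_append.comp hf hg

@[fun_prop]
theorem listCons' {f : α → β} {g : α → List β} (hf : Primrec f) (hg : Primrec g) :
    Primrec fun a => f a :: g a := list_cons.comp hf hg

@[fun_prop]
theorem listRange' {f : α → ℕ} (hf : Primrec f) : Primrec fun a => List.range (f a) :=
  list_range.comp hf

@[fun_prop]
theorem listLength' {f : α → List β} (hf : Primrec f) : Primrec fun a => (f a).length :=
  list_length.comp hf

@[fun_prop]
theorem listGetD' {f : α → List β} {g : α → ℕ} {d : β} (hf : Primrec f) (hg : Primrec g) :
    Primrec fun a => (f a).getD (g a) d := (list_getD d).comp hf hg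

@[fun_prop]
theorem natIterate' {f : α → ℕ} {g : α → β} {h : α → β → β} (hf : Primrec f) (hg : Primrec g)
    (hh : Primrec fun p : α × β => h p.1 p.2) : Primrec fun a => (h a)^[f a] (g a) :=
  nat_iterate hf hg hh

@[fun_prop]
theorem listAny' {f : α → List β} {g : α → β → Bool} (hf : Primrec f)
    (hg : Primrec fun p : α × β => g p.1 p.2) : Primrec fun a => (f a).any (g a) := by
  have : Primrec fun a => (f a).foldr (fun b r => g a b || r) false :=
    listFoldr' hf (.const _) (by
      have := hg.comp (g := fun p : α × β × Bool => (p.1, p.2.1)) (by fun_prop)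
      fun_prop)
  refine this.of_eq fun a => ?_
  induction f a <;> simp_all

@[fun_prop]
theorem listAll' {f : α → List β} {g : α → β → Bool} (hf : Primrec f)
    (hg : Primrec fun p : α × β => g p.1 p.2) : Primrec fun a => (f a).all (g a) := by
  have : Primrec fun a => !(f a).any fun b => !g a b := by fun_prop
  refine this.of_eq fun a => ?_
  induction f a <;> simp_all

end

section Int

-- The encoding of `ℤ` interleaves the nonnegative and the negative integers. Arithmetic is reduced
-- to `ℕ` by writing `z = z.toNat - (-z).toNat`.

theorem encode_int_ofNat (n : ℕ) : Encodable.encode (Int.ofNat n) = 2 * n := rfl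

theorem encode_int_negSucc (n : ℕ) : Encodable.encode (Int.negSucc n) = 2 * n + 1 := rfl

theorem intToNat : Primrec Int.toNat := by
  have : Primrec fun z : ℤ =>
      bif Encodable.encode z % 2 == 0 then Encodable.encode z / 2 else 0 := by
    have := @Primrec.encode ℤ _
    fun_prop
  refine this.of_eq fun z => ?_
  cases z with
  | ofNat n => rw [encode_int_ofNat]; simp
  | negSucc n => rw [encode_int_negSucc]; simp [Nat.add_mod]

theorem intNegToNat : Primrec fun z : ℤ => (-z).toNat := by
  have : Primrec fun z : ℤ =>
      bif Encodable.encode z % 2 == 0 then 0 else Encodable.encode z / 2 + 1 := by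
    have := @Primrec.encode ℤ _
    fun_prop
  refine this.of_eq fun z => ?_
  cases z with
  | ofNat n => rw [encode_int_ofNat]; simp
  | negSucc n => rw [encode_int_negSucc]; simp [Nat.add_mod, Int.neg_negSucc]; omega

theorem intSubNat : Primrec fun p : ℕ × ℕ => (p.1 : ℤ) - p.2 := by
  have : Primrec fun p : ℕ × ℕ =>
      bif Nat.ble p.2 p.1 then 2 * (p.1 - p.2) else 2 * (p.2 - p.1 - 1) + 1 := by fun_prop
  refine encode_iff.1 (this.of_eq fun p => ?_)
  obtain ⟨a, b⟩ := p
  by_cases h : b ≤ a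
  · have e : (a : ℤ) - b = Int.ofNat (a - b) := by simp [h]
    simp only [e, encode_int_ofNat, Nat.ble_eq_true_of_le h, cond_true]
  · have e : (a : ℤ) - b = Int.negSucc (b - a - 1) := by rw [Int.negSucc_eq]; omega
    have h' : Nat.ble b a = false := by rwa [← Bool.not_eq_true, Nat.ble_eq]
    simp only [e, encode_int_negSucc, h', cond_false]

variable {α : Type*} [Primcodable α]

@[fun_prop]
theorem intToNat' {f : α → ℤ} (hf : Primrec f) : Primrec fun a => (f a).toNat :=
  intToNat.comp hf

@[fun_prop]
theorem intCast' {f : α → ℕ} (hf : Primrec f) : Primrec fun a => (f a : ℤ) :=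
  (intSubNat.comp (hf.pair (.const 0))).of_eq fun a => by simp

@[fun_prop]
theorem intNeg' {f : α → ℤ} (hf : Primrec f) : Primrec fun a => -f a :=
  (intSubNat.comp ((intNegToNat.comp hf).pair (intToNat.comp hf))).of_eq fun a => by
    simp only; omega

@[fun_prop]
theorem intAdd' {f g : α → ℤ} (hf : Primrec f) (hg : Primrec g) : Primrec fun a => f a + g a :=
  (intSubNat.comp (g := fun a => ((f a).toNat + (g a).toNat, (-f a).toNat + (-g a).toNat))
    (by fun_prop)).of_eq fun a => by simp only; omega

@[fun_prop]
theorem intSub' {f g : α → ℤ} (hf : Primrec f) (hg : Primrec g) : Primrec fun a => f a - g a :=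
  (intAdd' hf (intNeg' hg)).of_eq fun _ => (sub_eq_add_neg _ _).symm

@[fun_prop]
theorem intMul' {f g : α → ℤ} (hf : Primrec f) (hg : Primrec g) : Primrec fun a => f a * g a :=
  (intSubNat.comp (g := fun a => ((f a).toNat * (g a).toNat + (-f a).toNat * (-g a).toNat,
      (f a).toNat * (-g a).toNat + (-f a).toNat * (g a).toNat)) (by fun_prop)).of_eq fun a => by
    have h₁ : f a = (f a).toNat - (-f a).toNat := by omega
    have h₂ : g a = (g a).toNat - (-g a).toNat := by omega
    conv_rhs => rw [h₁, h₂]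
    push_cast
    ring

@[fun_prop]
theorem intNatAbs' {f : α → ℤ} (hf : Primrec f) : Primrec fun a => (f a).natAbs := by
  have : Primrec fun a => (f a).toNat + (-f a).toNat := by fun_prop
  exact this.of_eq fun a => by omega

@[fun_prop]
theorem intSign' {f : α → ℤ} (hf : Primrec f) : Primrec fun a => (f a).sign := by
  have : Primrec fun a => ((min 1 (f a).toNat : ℕ) : ℤ) - (min 1 (-f a).toNat : ℕ) := by fun_prop
  refine this.of_eq fun a => ?_
  rcases lt_trichotomy (f a) 0 with h | h | h
  · rw [Int.sign_eq_neg_one_of_neg h]; omega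
  · simp [h]
  · rw [Int.sign_eq_one_of_pos h]; omega

end Int

end Primrec

namespace PForm

theorem encode_eq_toNat (φ : PForm) : Encodable.encode φ = φ.toNat := rfl

section

variable {α : Type*} [Primcodable α]

@[fun_prop]
theorem primrec_atom {f : α → ℤ} {g : α → List ℤ} (hf : Primrec f) (hg : Primrec g) :
    Primrec fun a => atom (f a) (g a) := by
  have h : Primrec fun a => 4 * Encodable.encode (f a, g a) := by
    have := Primrec.encode.comp (hf.pair hg)
    fun_prop
  exact Primrec.encode_iff.1 h

@[fun_prop]
theorem primrec_not {f : α → PForm} (hf : Primrec f) : Primrec fun a => not (f a) := by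
  have h : Primrec fun a => 4 * Encodable.encode (f a) + 1 := by
    have := Primrec.encode.comp hf
    fun_prop
  exact Primrec.encode_iff.1 h

@[fun_prop]
theorem primrec_and {f g : α → PForm} (hf : Primrec f) (hg : Primrec g) :
    Primrec fun a => and (f a) (g a) := by
  have h : Primrec fun a => 4 * Nat.pair (Encodable.encode (f a)) (Encodable.encode (g a)) + 2 := by
    have := Primrec.encode.comp hf
    have := Primrec.encode.comp hg
    fun_prop
  exact Primrec.encode_iff.1 h

@[fun_prop]
theorem primrec_ex {f : α → ℕ} {g : α → PForm} (hf : Primrec f) (hg : Primrec g) :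
    Primrec fun a => ex (f a) (g a) := by
  have h : Primrec fun a => 4 * Nat.pair (f a) (Encodable.encode (g a)) + 3 := by
    have := Primrec.encode.comp hg
    fun_prop
  exact Primrec.encode_iff.1 h

end

/-- Structural recursion on formulas preserves primitive recursiveness: it is a course-of-values
recursion on Gödel numbers. -/
theorem primrec_of_structural {σ : Type*} [Primcodable σ] [Inhabited σ] {F : PForm → σ}
    {fa : ℤ → List ℤ → σ} {fn : σ → σ} {fc : σ → σ → σ} {fe : ℕ → σ → σ}
    (ha : Primrec fun p : ℤ × List ℤ => fa p.1 p.2) (hn : Primrec fn)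
    (hc : Primrec fun p : σ × σ => fc p.1 p.2) (he : Primrec fun p : ℕ × σ => fe p.1 p.2)
    (h_atom : ∀ c a, F (atom c a) = fa c a) (h_not : ∀ φ, F (not φ) = fn (F φ))
    (h_and : ∀ φ ψ, F (and φ ψ) = fc (F φ) (F ψ)) (h_ex : ∀ i φ, F (ex i φ) = fe i (F φ)) :
    Primrec F := by
  let d : σ := default
  let G : Unit → List σ → Option σ := fun _ l =>
    let n := l.length
    let m := n / 4
    some (bif n % 4 == 0 then
        fa (Denumerable.ofNat (ℤ × List ℤ) m).1 (Denumerable.ofNat (ℤ × List ℤ) m).2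
      else bif n % 4 == 1 then fn (l.getD m d)
      else bif n % 4 == 2 then fc (l.getD m.unpair.1 d) (l.getD m.unpair.2 d)
      else fe m.unpair.1 (l.getD m.unpair.2 d))
  have hG : Primrec₂ G := by
    have h0 : Primrec fun p : Unit × List σ =>
        (Denumerable.ofNat (ℤ × List ℤ) (p.2.length / 4)) :=
      (Primrec.ofNat _).comp (by fun_prop)
    have h1 := ha.comp h0
    have h2 := hn.comp (g := fun p : Unit × List σ => p.2.getD (p.2.length / 4) d) (by fun_prop)
    have h3 := hc.comp (g := fun p : Unit × List σ =>
      (p.2.getD (p.2.length / 4).unpair.1 d, p.2.getD (p.2.length / 4).unpair.2 d)) (by fun_prop)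
    have h4 := he.comp (g := fun p : Unit × List σ =>
      ((p.2.length / 4).unpair.1, p.2.getD (p.2.length / 4).unpair.2 d)) (by fun_prop)
    refine Primrec.option_some.comp ?_
    fun_prop
  have key : Primrec₂ fun (_ : Unit) n => F (ofNat n) := by
    refine Primrec.nat_strong_rec _ hG fun _ n => ?_
    have get : ∀ k, k < n →
        ((List.range n).map fun n => F (ofNat n)).getD k d = F (ofNat k) := fun k hk => by
      simp [List.getD, hk]
    simp only [G, List.length_map, List.length_range]
    conv_rhs => rw [ofNat]
    split_ifs with h0 h1 h2
    · simp [h0, h_atom]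
    · rw [get _ (by omega)]
      simp [h1, h_not]
    · rw [get _ ((Nat.unpair_left_le _).trans_lt (by omega)),
        get _ ((Nat.unpair_right_le _).trans_lt (by omega))]
      simp [h2, h_and]
    · rw [beq_false_of_ne h0, beq_false_of_ne h1, beq_false_of_ne h2,
        get _ ((Nat.unpair_right_le _).trans_lt (by omega))]
      simp [h_ex]
  have h : Primrec fun φ : PForm => F (ofNat (Encodable.encode φ)) :=
    key.comp (.const ()) .encode
  exact h.of_eq fun φ => by rw [encode_eq_toNat, ofNat_toNat]

end PForm

/-! ### Quantifier elimination for Presburger arithmetic -/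

namespace QE

/-- A homogeneous linear term, as a list of monomials `(coefficient, index)`; repetitions of an
index are allowed. A constant is a monomial of index `0`, the variable of index `0` being read
as `1`. -/
abbrev Term := List (ℤ × ℕ)

/-- The value of a term. -/
def Term.val (w : ℕ → ℤ) (t : Term) : ℤ := t.foldr (fun p r => p.1 * w p.2 + r) 0

/-- The total coefficient of index `i` in a term. -/
def Term.coeff (i : ℕ) (t : Term) : ℤ := t.foldr (fun p r => (bif p.2 == i then p.1 else 0) + r) 0

/-- The term without its monomials of index `i`. -/
def Term.drop (i : ℕ) (t : Term) : Term := t.flatMap fun p => bif p.2 == i then [] else [p]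

/-- An integer multiple of a term. -/
def Term.scale (a : ℤ) (t : Term) : Term := t.map fun p => (a * p.1, p.2)

@[simp] theorem Term.val_nil (w : ℕ → ℤ) : Term.val w [] = 0 := rfl

@[simp] theorem Term.val_cons (w : ℕ → ℤ) (p : ℤ × ℕ) (t : Term) :
    Term.val w (p :: t) = p.1 * w p.2 + Term.val w t := rfl

@[simp] theorem Term.val_append (w : ℕ → ℤ) (s t : Term) :
    Term.val w (s ++ t) = Term.val w s + Term.val w t := by
  induction s with
  | nil => simp
  | cons p s ih => rw [List.cons_append, val_cons, val_cons, ih, add_assoc]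

@[simp] theorem Term.val_scale (w : ℕ → ℤ) (a : ℤ) (t : Term) :
    Term.val w (Term.scale a t) = a * Term.val w t := by
  induction t with
  | nil => simp [scale]
  | cons p t ih =>
    have : scale a (p :: t) = (a * p.1, p.2) :: scale a t := rfl
    rw [this, val_cons, val_cons, ih]
    ring

theorem Term.val_eq (w : ℕ → ℤ) (i : ℕ) (t : Term) :
    Term.val w t = Term.coeff i t * w i + Term.val w (Term.drop i t) := by
  induction t with
  | nil => simp [coeff, drop]
  | cons p t ih =>
    have h₁ : coeff i (p :: t) = (bif p.2 == i then p.1 else 0) + coeff i t := rfl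
    have h₂ : drop i (p :: t) = (bif p.2 == i then [] else [p]) ++ drop i t := rfl
    rw [val_cons, h₁, h₂, val_append, ih]
    by_cases h : p.2 = i
    · subst h; simp; ring
    · rw [beq_false_of_ne h]; simp; ring

theorem Term.val_drop_update (w : ℕ → ℤ) (i : ℕ) (z : ℤ) (t : Term) :
    Term.val (Function.update w i z) (Term.drop i t) = Term.val w (Term.drop i t) := by
  induction t with
  | nil => rfl
  | cons p t ih =>
    have h₂ : drop i (p :: t) = (bif p.2 == i then [] else [p]) ++ drop i t := rfl
    rw [h₂, val_append, val_append, ih]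
    by_cases h : p.2 = i
    · simp [h]
    · rw [beq_false_of_ne h]; simp [Function.update_of_ne h]

/-- An atomic constraint `(m, t)`: the inequality `t ≤ 0` if `m = 0`, and the divisibility `m ∣ t`
if `m ≠ 0`. -/
abbrev Atom := ℕ × Term

/-- Truth of an atomic constraint. -/
def Atom.Holds (w : ℕ → ℤ) (p : Atom) : Prop :=
  if p.1 = 0 then Term.val w p.2 ≤ 0 else (p.1 : ℤ) ∣ Term.val w p.2

/-- A conjunction of atomic constraints. -/
abbrev Clause := List Atom

/-- Truth of a conjunction of atomic constraints. -/
def Clause.Holds (w : ℕ → ℤ) (C : Clause) : Prop := ∀ p ∈ C, Atom.Holds w p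

/-- A disjunctive normal form. -/
abbrev DNF := List Clause

/-- Truth of a disjunctive normal form. -/
def DNF.Holds (w : ℕ → ℤ) (D : DNF) : Prop := ∃ C ∈ D, Clause.Holds w C

/-- The constraint obtained from `p` by the virtual substitution `x i := s / a`, cleared of
denominators. -/
def Atom.subst (i a : ℕ) (s : Term) (p : Atom) : Atom :=
  (a * p.1, Term.scale a (Term.drop i p.2) ++ Term.scale (Term.coeff i p.2) s)

theorem Atom.holds_subst {w : ℕ → ℤ} {i a : ℕ} {s : Term} {z : ℤ} (ha : 0 < a)
    (h : a * z = Term.val w s) (p : Atom) :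
    Atom.Holds w (p.subst i a s) ↔ Atom.Holds (Function.update w i z) p := by
  have key : Term.val w (p.subst i a s).2 = a * Term.val (Function.update w i z) p.2 := by
    rw [Term.val_eq (Function.update w i z) i p.2, Term.val_drop_update, Function.update_self]
    simp only [Atom.subst, Term.val_append, Term.val_scale, ← h]
    ring
  have ha' : (0 : ℤ) < a := by exact_mod_cast ha
  rw [Holds, Holds, key]
  simp only [Atom.subst, mul_eq_zero, ha.ne', false_or, Nat.cast_mul,
    mul_dvd_mul_iff_left ha'.ne']
  split_ifs
  · exact ⟨fun h => nonpos_of_mul_nonpos_right h ha', mul_nonpos_of_nonneg_of_nonpos ha'.le⟩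
  · rfl

/-- A common period of the divisibility constraints of a clause, in every variable. -/
def Clause.period (C : Clause) : ℕ := C.foldr (fun p r => max 1 p.1 * r) 1

theorem Clause.period_pos (C : Clause) : 0 < C.period := by
  induction C with
  | nil => exact Nat.one_pos
  | cons p C ih => exact Nat.mul_pos (by omega) ih

theorem Clause.dvd_period {C : Clause} {p : Atom} (hp : p ∈ C) (h : p.1 ≠ 0) : p.1 ∣ C.period := by
  induction C with
  | nil => simp at hp
  | cons q C ih =>
    change _ ∣ max 1 q.1 * Clause.period C
    rcases List.mem_cons.1 hp with rfl | hp
    · rw [max_eq_right (by omega)]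
      exact dvd_mul_right _ _
    · exact (ih hp).mul_left _

/-- The denominator of the zero of a constraint, as a function of the variable of index `i`;
it is `1` if the constraint does not contain this variable. -/
def Atom.den (i : ℕ) (p : Atom) : ℕ := max 1 (Term.coeff i p.2).natAbs

/-- The numerator of the zero of a constraint, as a function of the variable of index `i`;
it is `0` if the constraint does not contain this variable. -/
def Atom.num (i : ℕ) (p : Atom) : Term :=
  Term.scale (-(Term.coeff i p.2).sign) (Term.drop i p.2)

/-- Elimination of `∃ x i` from a clause: `x i` runs through the points close to the zero of one of
the constraints, or close to `0`. The point `0` comes in as the zero of the trivial constraint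
`(0, [])`. -/
def Clause.elim (i : ℕ) (C : Clause) : DNF :=
  ((0, []) :: C : Clause).flatMap fun p =>
    (List.range (2 * (p.den i * C.period) + 1)).map fun l : ℕ =>
      (p.den i, ((l : ℤ) - (p.den i * C.period : ℕ), 0) :: p.num i) ::
        C.map (Atom.subst i (p.den i) (((l : ℤ) - (p.den i * C.period : ℕ), 0) :: p.num i))

theorem Atom.den_pos (i : ℕ) (p : Atom) : 0 < p.den i := by
  unfold den
  omega

theorem Atom.holds_of_ne_zero {w : ℕ → ℤ} {p : Atom} (h : p.1 ≠ 0) :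
    p.Holds w ↔ (p.1 : ℤ) ∣ Term.val w p.2 := by
  rw [Holds, if_neg h]

theorem Term.val_update_add (w : ℕ → ℤ) (i : ℕ) (z d : ℤ) (t : Term) :
    Term.val (Function.update w i (z + d)) t =
      Term.val (Function.update w i z) t + Term.coeff i t * d := by
  rw [val_eq _ i, val_eq (Function.update w i z) i, val_drop_update, val_drop_update,
    Function.update_self, Function.update_self]
  ring

/-- A constraint that changes its truth value within one period of the divisibility constraints
is an inequality, whose zero is near by. -/
theorem Atom.near_zero {w : ℕ → ℤ} {i : ℕ} {C : Clause} {p : Atom} {z ε : ℤ} (hp : p ∈ C)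
    (hε : |ε| ≤ C.period) (hd : (C.period : ℤ) ∣ ε)
    (h₁ : p.Holds (Function.update w i z))
    (h₂ : ¬ p.Holds (Function.update w i (z + ε))) :
    |p.den i * z - Term.val w (p.num i)| ≤ p.den i * C.period := by
  by_cases h0 : p.1 = 0
  · rw [Holds, if_pos h0] at h₁ h₂
    rw [Term.val_update_add] at h₂
    push Not at h₂
    set α := Term.coeff i p.2 with hα
    have hv : Term.val (Function.update w i z) p.2 = α * z + Term.val w (Term.drop i p.2) := by
      rw [Term.val_eq _ i, Term.val_drop_update, Function.update_self]
    have hb : |α * z + Term.val w (Term.drop i p.2)| ≤ |α| * C.period := by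
      rw [hv] at h₁ h₂
      rw [abs_of_nonpos h₁]
      calc _ ≤ α * ε := by linarith
        _ ≤ |α * ε| := le_abs_self _
        _ = |α| * |ε| := abs_mul _ _
        _ ≤ _ := by gcongr
    have hα0 : α ≠ 0 := by
      intro h
      rw [h] at h₂
      linarith
    have hden : (p.den i : ℤ) = |α| := by
      have := Int.natAbs_pos.2 hα0
      rw [den, max_eq_right (by omega), Int.natCast_natAbs]
    rw [hden, num, Term.val_scale, ← hα]
    have e : |α| * z - -α.sign * Term.val w (Term.drop i p.2) =
        α.sign * (α * z + Term.val w (Term.drop i p.2)) := by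
      rw [← Int.sign_mul_self_eq_abs]
      ring
    rw [e, abs_mul, Int.abs_sign_of_ne_zero hα0, one_mul]
    exact hb
  · rw [holds_of_ne_zero h0] at h₁ h₂
    rw [Term.val_update_add] at h₂
    refine absurd (dvd_add h₁ (Dvd.dvd.mul_left ?_ _)) h₂
    exact (Int.natCast_dvd_natCast.2 (Clause.dvd_period hp h0)).trans hd

/-- A clause satisfied by some value of `x i` is satisfied by one close to the zero of one of its
constraints, or of the trivial constraint. -/
theorem Clause.exists_near {w : ℕ → ℤ} {i : ℕ} {C : Clause} {z₀ : ℤ}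
    (h : C.Holds (Function.update w i z₀)) :
    ∃ z, C.Holds (Function.update w i z) ∧ ∃ p ∈ ((0, []) :: C : Clause),
      |p.den i * z - Term.val w (p.num i)| ≤ p.den i * C.period := by
  have hD : (0 : ℤ) < C.period := by exact_mod_cast C.period_pos
  by_cases hall : ∀ k : ℤ, C.Holds (Function.update w i (z₀ + k * C.period))
  -- The clause is periodic in this variable: a representative within the first period will do.
  · refine ⟨z₀ % C.period, ?_, (0, []), List.mem_cons_self, ?_⟩
    · convert hall (-(z₀ / C.period)) using 2
      rw [Int.emod_def]
      ring
    · have h₁ := Int.emod_nonneg z₀ hD.ne'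
      have h₂ := Int.emod_lt_of_pos z₀ hD
      have e : Atom.den i (0, []) = 1 := rfl
      have e' : Term.val w (Atom.num i (0, [])) = 0 := rfl
      rw [e, e', Nat.cast_one, one_mul, one_mul, sub_zero, abs_of_nonneg h₁]
      exact h₂.le
  · push Not at hall
    obtain ⟨k, hk⟩ := hall
    -- The truth value of the clause changes between two neighbours in the progression.
    have step : ∃ (j : ℤ) (ε : ℤ), |ε| ≤ C.period ∧ (C.period : ℤ) ∣ ε ∧
        C.Holds (Function.update w i j) ∧ ¬ C.Holds (Function.update w i (j + ε)) := by
      by_contra! hcon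
      refine hk ?_
      induction k using Int.induction_on with
      | zero => simpa using h
      | succ k ih =>
        have := hcon (z₀ + k * C.period) C.period (abs_of_pos hD).le dvd_rfl
        by_cases h' : C.Holds (Function.update w i (z₀ + k * C.period))
        · convert this h' using 2
          ring
        · exact absurd (ih h') h'
      | pred k ih =>
        have := hcon (z₀ + (-k) * C.period) (-C.period) (by rw [abs_neg, abs_of_pos hD])
          (dvd_neg.2 dvd_rfl)
        by_cases h' : C.Holds (Function.update w i (z₀ + (-k) * C.period))
        · convert this h' using 2
          ring
        · exact absurd (ih h') h'
    obtain ⟨z, ε, hε, hd, h₁, h₂⟩ := step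
    rw [Holds] at h₂
    push Not at h₂
    obtain ⟨p, hp, hp'⟩ := h₂
    exact ⟨z, h₁, p, List.mem_cons_of_mem _ hp, Atom.near_zero hp hε hd (h₁ p hp) hp'⟩

theorem Clause.holds_elim {w : ℕ → ℤ} (hw : w 0 = 1) {i : ℕ} (C : Clause) :
    DNF.Holds w (C.elim i) ↔ ∃ z, C.Holds (Function.update w i z) := by
  constructor
  · rintro ⟨C', hC', h⟩
    simp only [elim, List.mem_flatMap, List.mem_map] at hC'
    obtain ⟨p, -, l, -, rfl⟩ := hC'
    obtain ⟨z, hz⟩ := (Atom.holds_of_ne_zero (p.den_pos i).ne').1 (h _ List.mem_cons_self)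
    refine ⟨z, fun q hq => ?_⟩
    rw [← Atom.holds_subst (p.den_pos i) hz.symm]
    exact h _ (List.mem_cons_of_mem _ (List.mem_map_of_mem hq))
  · rintro ⟨z₀, h₀⟩
    obtain ⟨z, hz, p, hp, hb⟩ := exists_near h₀
    obtain ⟨hb₁, hb₂⟩ := abs_le.1 hb
    set j := p.den i * z - Term.val w (p.num i) with hj
    obtain ⟨l, hl⟩ : ∃ l : ℕ, (l : ℤ) = j + (p.den i * C.period : ℕ) :=
      ⟨(j + (p.den i * C.period : ℕ)).toNat, by push_cast; omega⟩
    refine ⟨_, List.mem_flatMap.2 ⟨p, hp, List.mem_map.2 ⟨l, ?_, rfl⟩⟩, ?_⟩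
    · rw [List.mem_range]
      push_cast at hl
      zify
      linarith
    · have e : (p.den i : ℤ) * z =
          Term.val w (((l : ℤ) - (p.den i * C.period : ℕ), 0) :: p.num i) := by
        rw [Term.val_cons, hw, hl]
        linarith
      intro q hq
      rcases List.mem_cons.1 hq with rfl | hq
      · rw [Atom.holds_of_ne_zero (p.den_pos i).ne']
        exact ⟨z, e.symm⟩
      · obtain ⟨r, hr, rfl⟩ := List.mem_map.1 hq
        rw [Atom.holds_subst (p.den_pos i) e]
        exact hz r hr

/-- Elimination of `∃ x i` from a disjunctive normal form. -/
def DNF.elim (i : ℕ) (D : DNF) : DNF := D.flatMap (Clause.elim i)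

theorem DNF.holds_elim {w : ℕ → ℤ} (hw : w 0 = 1) (i : ℕ) (D : DNF) :
    (D.elim i).Holds w ↔ ∃ z, D.Holds (Function.update w i z) := by
  constructor
  · rintro ⟨C', hC', h⟩
    obtain ⟨C, hC, hC'⟩ := List.mem_flatMap.1 hC'
    obtain ⟨z, hz⟩ := (Clause.holds_elim hw C).1 ⟨C', hC', h⟩
    exact ⟨z, C, hC, hz⟩
  · rintro ⟨z, C, hC, hz⟩
    obtain ⟨C', hC', h⟩ := (Clause.holds_elim hw C).2 ⟨z, hz⟩
    exact ⟨C', List.mem_flatMap.2 ⟨C, hC, hC'⟩, h⟩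

/-- Conjunction of disjunctive normal forms. -/
def DNF.and (D E : DNF) : DNF := D.flatMap fun C => E.map fun C' => C ++ C'

theorem DNF.holds_and (w : ℕ → ℤ) (D E : DNF) : (D.and E).Holds w ↔ D.Holds w ∧ E.Holds w := by
  constructor
  · rintro ⟨X, hX, h⟩
    simp only [DNF.and, List.mem_flatMap, List.mem_map] at hX
    obtain ⟨C, hC, C', hC', rfl⟩ := hX
    exact ⟨⟨C, hC, fun p hp => h p (List.mem_append_left _ hp)⟩,
      ⟨C', hC', fun p hp => h p (List.mem_append_right _ hp)⟩⟩
  · rintro ⟨⟨C, hC, h⟩, ⟨C', hC', h'⟩⟩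
    refine ⟨C ++ C', List.mem_flatMap.2 ⟨C, hC, List.mem_map_of_mem hC'⟩, fun p hp => ?_⟩
    exact (List.mem_append.1 hp).elim (h p) (h' p)

/-- The negation of an atomic constraint: `1 - t ≤ 0`, or `m ∣ t + r` for some `0 < r < m`. -/
def Atom.neg (p : Atom) : DNF :=
  bif p.1 == 0 then [[(0, (1, 0) :: Term.scale (-1) p.2)]]
  else (List.range (p.1 - 1)).map fun r => [(p.1, (((r + 1 : ℕ) : ℤ), 0) :: p.2)]

theorem Atom.holds_neg {w : ℕ → ℤ} (hw : w 0 = 1) (p : Atom) :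
    p.neg.Holds w ↔ ¬ p.Holds w := by
  by_cases h0 : p.1 = 0
  · simp [Atom.neg, DNF.Holds, Clause.Holds, Atom.Holds, h0, hw]
    omega
  · have hm : (0 : ℤ) < p.1 := by omega
    rw [holds_of_ne_zero h0]
    simp only [Atom.neg, beq_false_of_ne h0, cond_false, DNF.Holds, List.mem_map, List.mem_range,
      Clause.Holds]
    constructor
    · rintro ⟨_, ⟨r, hr, rfl⟩, h⟩ hd
      have h := (holds_of_ne_zero (by exact h0)).1 (h _ (List.mem_singleton_self _))
      rw [Term.val_cons, hw, mul_one] at h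
      have := Int.le_of_dvd (by positivity) ((dvd_add_left hd).1 h)
      simp only at this
      omega
    · intro hd
      have h₁ := Int.emod_nonneg (-Term.val w p.2) hm.ne'
      have h₂ := Int.emod_lt_of_pos (-Term.val w p.2) hm
      have h₃ : (-Term.val w p.2) % p.1 ≠ 0 := fun h =>
        hd (by rw [← dvd_neg]; exact Int.dvd_of_emod_eq_zero h)
      refine ⟨_, ⟨((-Term.val w p.2) % p.1 - 1).toNat, by omega, rfl⟩, fun q hq => ?_⟩
      rw [List.mem_singleton.1 hq, holds_of_ne_zero (by exact h0), Term.val_cons, hw, mul_one]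
      have e : ((((-Term.val w p.2) % p.1 - 1).toNat + 1 : ℕ) : ℤ) = (-Term.val w p.2) % p.1 := by
        omega
      simp only [e]
      rw [Int.emod_def]
      exact ⟨-(-Term.val w p.2 / p.1), by ring⟩

/-- Negation of a disjunctive normal form. -/
def DNF.neg (D : DNF) : DNF := D.foldr (fun C E => DNF.and (C.flatMap Atom.neg) E) [[]]

theorem DNF.holds_neg {w : ℕ → ℤ} (hw : w 0 = 1) (D : DNF) : D.neg.Holds w ↔ ¬ D.Holds w := by
  induction D with
  | nil => simp [DNF.neg, DNF.Holds, Clause.Holds]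
  | cons C D ih =>
    have h₁ : DNF.neg (C :: D) = DNF.and (C.flatMap Atom.neg) (DNF.neg D) := rfl
    have h₂ : DNF.Holds w (C.flatMap Atom.neg) ↔ ¬ C.Holds w := by
      rw [Clause.Holds]
      push Not
      constructor
      · rintro ⟨C', hC', h⟩
        obtain ⟨p, hp, hp'⟩ := List.mem_flatMap.1 hC'
        exact ⟨p, hp, (Atom.holds_neg hw p).1 ⟨C', hp', h⟩⟩
      · rintro ⟨p, hp, h⟩
        obtain ⟨C', hC', h⟩ := (Atom.holds_neg hw p).2 h
        exact ⟨C', List.mem_flatMap.2 ⟨p, hp, hC'⟩, h⟩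
    rw [h₁, DNF.holds_and, ih, h₂, DNF.Holds, DNF.Holds]
    simp

/-- The inequality `c + ∑ i, a i * x i ≤ 0` as a constraint; the variable `x i` gets index
`i + 1`. -/
def ofAtom (c : ℤ) (a : List ℤ) : DNF :=
  [[(0, (c, 0) :: (List.range a.length).map fun i => (a.getD i 0, i + 1))]]

/-- A disjunctive normal form equivalent to a formula. -/
def dnf : PForm → DNF
  | .atom c a => ofAtom c a
  | .not φ => (dnf φ).neg
  | .and φ ψ => (dnf φ).and (dnf ψ)
  | .ex i φ => (dnf φ).elim (i + 1)

/-- The valuation of terms that belongs to a valuation of the variables of formulas. -/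
def shift (v : ℕ → ℤ) : ℕ → ℤ
  | 0 => 1
  | i + 1 => v i

theorem shift_update (v : ℕ → ℤ) (i : ℕ) (z : ℤ) :
    shift (Function.update v i z) = Function.update (shift v) (i + 1) z := by
  funext j
  cases j with
  | zero => rw [Function.update_of_ne (by omega)]; rfl
  | succ j => by_cases h : j = i <;> simp [shift, h]

theorem holds_ofAtom (v : ℕ → ℤ) (c : ℤ) (a : List ℤ) :
    (ofAtom c a).Holds (shift v) ↔ (PForm.atom c a).Realize v := by
  have h : ∀ n, Term.val (shift v) ((List.range n).map fun i => (a.getD i 0, i + 1)) =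
      ∑ i ∈ Finset.range n, a.getD i 0 * v i := by
    intro n
    induction n with
    | zero => rfl
    | succ n ih =>
      rw [List.range_succ, List.map_append, Term.val_append, ih, Finset.sum_range_succ]
      simp [shift]
  simp only [ofAtom, DNF.Holds, Clause.Holds, List.mem_singleton, exists_eq_left, forall_eq,
    Atom.Holds, if_true, Term.val_cons, h, PForm.Realize, shift, mul_one]

theorem holds_dnf (φ : PForm) (v : ℕ → ℤ) : (dnf φ).Holds (shift v) ↔ φ.Realize v := by
  induction φ generalizing v with
  | atom c a => exact holds_ofAtom v c a
  | not φ ih => rw [dnf, DNF.holds_neg rfl, ih, PForm.Realize]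
  | and φ ψ ih₁ ih₂ => rw [dnf, DNF.holds_and, ih₁, ih₂, PForm.Realize]
  | ex i φ ih =>
    rw [dnf, DNF.holds_elim rfl, PForm.Realize]
    simp only [← shift_update, ih]

/-- The truth value of a disjunctive normal form when all variables are `0`. -/
def DNF.eval (D : DNF) : Bool :=
  D.any fun C => C.all fun p =>
    bif p.1 == 0 then (Term.coeff 0 p.2).toNat == 0 else (Term.coeff 0 p.2).natAbs % p.1 == 0

theorem Term.val_shift_zero (t : Term) : Term.val (shift 0) t = Term.coeff 0 t := by
  induction t with
  | nil => rfl
  | cons p t ih =>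
    have h₁ : coeff 0 (p :: t) = (bif p.2 == 0 then p.1 else 0) + coeff 0 t := rfl
    rw [val_cons, h₁, ih]
    obtain ⟨a, _ | i⟩ := p <;> simp [shift]

theorem DNF.eval_iff (D : DNF) : D.eval = true ↔ D.Holds (shift 0) := by
  simp only [DNF.eval, List.any_eq_true, List.all_eq_true, DNF.Holds, Clause.Holds]
  refine exists_congr fun C => and_congr_right fun _ => forall₂_congr fun p _ => ?_
  by_cases h : p.1 = 0
  · simp [Atom.Holds, h, Term.val_shift_zero]
  · rw [Atom.holds_of_ne_zero h, Term.val_shift_zero, beq_false_of_ne h, cond_false, beq_iff_eq,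
      ← Nat.dvd_iff_mod_eq_zero, ← Int.natCast_dvd]

section Primrec

variable {α : Type*} [Primcodable α]

@[fun_prop]
theorem Term.primrec_coeff {f : α → ℕ} {g : α → Term} (hf : Primrec f) (hg : Primrec g) :
    Primrec fun a => Term.coeff (f a) (g a) := by
  unfold Term.coeff
  fun_prop

@[fun_prop]
theorem Term.primrec_drop {f : α → ℕ} {g : α → Term} (hf : Primrec f) (hg : Primrec g) :
    Primrec fun a => Term.drop (f a) (g a) := by
  unfold Term.drop
  fun_prop

@[fun_prop]
theorem Term.primrec_scale {f : α → ℤ} {g : α → Term} (hf : Primrec f) (hg : Primrec g) :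
    Primrec fun a => Term.scale (f a) (g a) := by
  unfold Term.scale
  fun_prop

@[fun_prop]
theorem Atom.primrec_subst {f g : α → ℕ} {h : α → Term} {k : α → Atom} (hf : Primrec f)
    (hg : Primrec g) (hh : Primrec h) (hk : Primrec k) :
    Primrec fun a => Atom.subst (f a) (g a) (h a) (k a) := by
  unfold Atom.subst
  fun_prop

@[fun_prop]
theorem Clause.primrec_period {f : α → Clause} (hf : Primrec f) :
    Primrec fun a => Clause.period (f a) := by
  unfold Clause.period
  fun_prop

@[fun_prop]
theorem Atom.primrec_den {f : α → ℕ} {g : α → Atom} (hf : Primrec f) (hg : Primrec g) :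
    Primrec fun a => Atom.den (f a) (g a) := by
  unfold Atom.den
  fun_prop

@[fun_prop]
theorem Atom.primrec_num {f : α → ℕ} {g : α → Atom} (hf : Primrec f) (hg : Primrec g) :
    Primrec fun a => Atom.num (f a) (g a) := by
  unfold Atom.num
  fun_prop

@[fun_prop]
theorem Clause.primrec_elim {f : α → ℕ} {g : α → Clause} (hf : Primrec f) (hg : Primrec g) :
    Primrec fun a => Clause.elim (f a) (g a) := by
  unfold Clause.elim
  fun_prop

@[fun_prop]
theorem DNF.primrec_elim {f : α → ℕ} {g : α → DNF} (hf : Primrec f) (hg : Primrec g) :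
    Primrec fun a => DNF.elim (f a) (g a) := by
  unfold DNF.elim
  fun_prop

@[fun_prop]
theorem DNF.primrec_and {f g : α → DNF} (hf : Primrec f) (hg : Primrec g) :
    Primrec fun a => DNF.and (f a) (g a) := by
  unfold DNF.and
  fun_prop

@[fun_prop]
theorem Atom.primrec_neg {f : α → Atom} (hf : Primrec f) : Primrec fun a => Atom.neg (f a) := by
  unfold Atom.neg
  fun_prop

@[fun_prop]
theorem DNF.primrec_neg {f : α → DNF} (hf : Primrec f) : Primrec fun a => DNF.neg (f a) := by
  unfold DNF.neg
  fun_prop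

theorem primrec_ofAtom : Primrec fun p : ℤ × List ℤ => ofAtom p.1 p.2 := by
  unfold ofAtom
  fun_prop

@[fun_prop]
theorem DNF.primrec_eval {f : α → DNF} (hf : Primrec f) : Primrec fun a => DNF.eval (f a) := by
  unfold DNF.eval
  fun_prop

theorem primrec_dnf : Primrec dnf :=
  PForm.primrec_of_structural (fa := ofAtom) (fn := DNF.neg) (fc := DNF.and)
    (fe := fun i => DNF.elim (i + 1)) primrec_ofAtom (by fun_prop) (by fun_prop) (by fun_prop)
    (fun _ _ => rfl) (fun _ => rfl) (fun _ _ => rfl) (fun _ _ => rfl)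

end Primrec

/-- The decision procedure: truth of a formula when all free variables are `0`. -/
def decideZero (φ : PForm) : Bool := (dnf φ).eval

theorem decideZero_iff (φ : PForm) : decideZero φ = true ↔ φ.Realize 0 := by
  rw [decideZero, DNF.eval_iff, holds_dnf]

@[fun_prop]
theorem primrec_decideZero {α : Type*} [Primcodable α] {f : α → PForm} (hf : Primrec f) :
    Primrec fun a => decideZero (f a) := by
  unfold decideZero
  exact DNF.primrec_eval (primrec_dnf.comp hf)

end QE

/-! ### Periodicity of the powers of an integer matrix -/

/-- Each prime power `p ^ k` dividing `m` satisfies `p ^ k ≤ 2 φ(p ^ k) ≤ 2 φ(m)`. -/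
theorem Nat.dvd_factorial_two_mul_of_totient_le {m n : ℕ} (hm : 0 < m) (h : m.totient ≤ n) :
    m ∣ (2 * n).factorial := by
  refine (Nat.dvd_iff_prime_pow_dvd_dvd _ _).2 fun p k hp hk => ?_
  cases k with
  | zero => simp
  | succ k =>
    refine Nat.dvd_factorial (pow_pos hp.pos _) ?_
    have h₁ : (p ^ (k + 1)).totient ≤ m.totient :=
      Nat.le_of_dvd (Nat.totient_pos.2 hm) (Nat.totient_dvd_of_dvd hk)
    rw [Nat.totient_prime_pow_succ hp] at h₁
    calc p ^ (k + 1) = p ^ k * p := pow_succ _ _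
      _ ≤ p ^ k * (2 * (p - 1)) := Nat.mul_le_mul_left _ (by have := hp.two_le; omega)
      _ = 2 * (p ^ k * (p - 1)) := by ring
      _ ≤ 2 * n := by omega

open Polynomial in
/-- A divisor `p` of `X ^ k * (X ^ r - 1)` is a power of `X` times a product of distinct cyclotomic
polynomials `Φ_d`; the degree of `p` bounds the exponent and each `φ(d)`. -/
theorem Polynomial.dvd_X_pow_mul_X_pow_factorial_sub_one {p : ℚ[X]} {k r n : ℕ} (hr : 0 < r)
    (hp : p ∣ X ^ k * (X ^ r - 1)) (hp0 : p ≠ 0) (hn : p.natDegree ≤ n) :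
    p ∣ X ^ n * (X ^ (2 * n).factorial - 1) := by
  obtain ⟨d₁, d₂, h₁, h₂, rfl⟩ := exists_dvd_and_dvd_of_dvd_mul hp
  have hd₁ : d₁ ≠ 0 := left_ne_zero_of_mul hp0
  have hd₂ : d₂ ≠ 0 := right_ne_zero_of_mul hp0
  rw [natDegree_mul hd₁ hd₂] at hn
  refine mul_dvd_mul ?_ ?_
  · obtain ⟨i, -, hi⟩ := (dvd_prime_pow prime_X _).1 h₁
    have : d₁.natDegree = i := by
      rw [natDegree_eq_of_degree_eq (degree_eq_degree_of_associated hi), natDegree_X_pow]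
    exact hi.dvd.trans (pow_dvd_pow _ (by omega))
  · rw [← prod_cyclotomic_eq_X_pow_sub_one hr] at h₂
    rw [← prod_cyclotomic_eq_X_pow_sub_one (Nat.factorial_pos _)]
    rw [← Finset.prod_filter_mul_prod_filter_not _ (fun d => d.totient ≤ n)] at h₂
    -- The cyclotomic factors of too large a degree do not contribute to `d₂`.
    have hcop : IsCoprime d₂
        (∏ d ∈ r.divisors with ¬ d.totient ≤ n, cyclotomic d ℚ) := by
      refine IsCoprime.prod_right fun d hd => ?_
      rw [Finset.mem_filter, Nat.mem_divisors] at hd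
      have hd0 : 0 < d := Nat.pos_of_dvd_of_pos hd.1.1 hr
      refine ((cyclotomic.irreducible_rat hd0).coprime_iff_not_dvd.2 fun h => ?_).symm
      have := natDegree_le_of_dvd h hd₂
      rw [natDegree_cyclotomic] at this
      omega
    refine (hcop.dvd_of_dvd_mul_right h₂).trans (Finset.prod_dvd_prod_of_subset _ _ _ ?_)
    intro d hd
    rw [Finset.mem_filter, Nat.mem_divisors] at hd
    rw [Nat.mem_divisors]
    exact ⟨Nat.dvd_factorial_two_mul_of_totient_le (Nat.pos_of_dvd_of_pos hd.1.1 hr) hd.2,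
      (Nat.factorial_pos _).ne'⟩

/-- If the powers of an integer matrix of size `N` form a finite monoid, then they are periodic
with preperiod `N` and period `(2 N)!`. -/
theorem Matrix.pow_add_factorial_eq_of_finite_powers {N : ℕ} (A : Matrix (Fin N) (Fin N) ℤ)
    (hA : Finite (Submonoid.powers A)) : A ^ (N + (2 * N).factorial) = A ^ N := by
  obtain ⟨k, l, hkl, h⟩ : ∃ k l, k < l ∧ A ^ k = A ^ l := by
    have : ¬ Function.Injective fun n : ℕ => (⟨A ^ n, n, rfl⟩ : Submonoid.powers A) :=
      not_injective_infinite_finite _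
    rw [Function.Injective] at this
    push Not at this
    obtain ⟨a, b, hab, hne⟩ := this
    have hab : A ^ a = A ^ b := congrArg Subtype.val hab
    rcases lt_or_gt_of_ne hne with h | h
    · exact ⟨a, b, h, hab⟩
    · exact ⟨b, a, h, hab.symm⟩
  obtain ⟨r, rfl⟩ := Nat.exists_eq_add_of_lt hkl
  let f : Matrix (Fin N) (Fin N) ℤ →+* Matrix (Fin N) (Fin N) ℚ := (Int.castRingHom ℚ).mapMatrix
  have hf : Function.Injective f := Matrix.map_injective Int.cast_injective
  have hB : (f A) ^ k = (f A) ^ (k + r + 1) := by rw [← map_pow, ← map_pow, h]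
  have hmin : minpoly ℚ (f A) ∣ Polynomial.X ^ k * (Polynomial.X ^ (r + 1) - 1) := by
    refine minpoly.dvd _ _ ?_
    simp only [map_mul, map_sub, map_pow, Polynomial.aeval_X, map_one]
    rw [mul_sub, ← pow_add, ← add_assoc, ← hB, mul_one, sub_self]
  have hdeg : (minpoly ℚ (f A)).natDegree ≤ N := by
    have := Polynomial.natDegree_le_of_dvd (Matrix.minpoly_dvd_charpoly (f A))
      (Matrix.charpoly_monic _).ne_zero
    rwa [Matrix.charpoly_natDegree_eq_dim, Fintype.card_fin] at this
  have hdvd := Polynomial.dvd_X_pow_mul_X_pow_factorial_sub_one (Nat.succ_pos r) hmin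
    (minpoly.ne_zero (Matrix.isIntegral (f A))) hdeg
  have := (minpoly.dvd_iff).1 hdvd
  simp only [map_mul, map_sub, map_pow, Polynomial.aeval_X, map_one] at this
  rw [mul_sub, ← pow_add, mul_one, sub_eq_zero] at this
  apply hf
  rw [map_pow, map_pow, this]

/-! ### Iteration of affine maps -/

section Affine

variable {N : ℕ}

/-- The affine map `x ↦ A x + b`. -/
def affineMap (A : Matrix (Fin N) (Fin N) ℤ) (b x : Fin N → ℤ) : Fin N → ℤ := A.mulVec x + b

theorem affineMap_iterate (A : Matrix (Fin N) (Fin N) ℤ) (b x : Fin N → ℤ) (n : ℕ) :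
    (affineMap A b)^[n] x = (A ^ n).mulVec x + (affineMap A b)^[n] 0 := by
  induction n with
  | zero => simp
  | succ n ih =>
    rw [Function.iterate_succ_apply', ih, Function.iterate_succ_apply', affineMap, affineMap,
      Matrix.mulVec_add, Matrix.mulVec_mulVec, ← pow_succ', add_assoc]

/-- If `A ^ (p + q) = A ^ p`, then after `p` steps every further `q` steps translate the orbit by
one and the same vector. -/
theorem affineMap_iterate_add_mul {A : Matrix (Fin N) (Fin N) ℤ} {p q : ℕ}
    (h : A ^ (p + q) = A ^ p) (b x : Fin N → ℤ) (k : ℕ) :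
    (affineMap A b)^[q * k + p] x = (affineMap A b)^[p] x +
      (k : ℤ) • ((affineMap A b)^[p + q] 0 - (affineMap A b)^[p] 0) := by
  induction k with
  | zero => simp
  | succ k ih =>
    have e : q * (k + 1) + p = (p + q) + q * k := by ring
    have e' : q * k + p = p + q * k := by ring
    rw [e, Function.iterate_add_apply, affineMap_iterate, h]
    rw [e', Function.iterate_add_apply, affineMap_iterate] at ih
    push_cast
    rw [add_smul, one_smul, ← add_assoc, ← ih]
    abel

theorem forall_iterate_iff {A : Matrix (Fin N) (Fin N) ℤ} {p q : ℕ} (hq : 0 < q)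
    (h : A ^ (p + q) = A ^ p) (b x : Fin N → ℤ) (Q : (Fin N → ℤ) → Prop) :
    (∀ n, Q ((affineMap A b)^[n] x)) ↔
      (∀ r < p, Q ((affineMap A b)^[r] x)) ∧ ∀ k : ℕ, ∀ r < q, Q ((affineMap A b)^[r]
        ((affineMap A b)^[p] x +
          (k : ℤ) • ((affineMap A b)^[p + q] 0 - (affineMap A b)^[p] 0))) := by
  simp only [← affineMap_iterate_add_mul h, ← Function.iterate_add_apply]
  constructor
  · exact fun H => ⟨fun r _ => H r, fun k r _ => H _⟩
  · rintro ⟨H₁, H₂⟩ n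
    by_cases hn : n < p
    · exact H₁ n hn
    · have := H₂ ((n - p) / q) ((n - p) % q) (Nat.mod_lt _ hq)
      have e : (n - p) % q + (q * ((n - p) / q) + p) = n := by
        have := Nat.mod_add_div (n - p) q
        omega
      rwa [e] at this

theorem mem_wnt_iff (P : AffinePresentation N) (x : Fin N → ℤ) :
    x ∈ wnt P.rel ↔ ∀ n, P.guard.Sat ((affineMap P.A P.b)^[n] x) := by
  constructor
  · rintro ⟨S, hS, hx⟩ n
    obtain ⟨s, hs, h⟩ := hS x hx
    have : ∀ n, s n = (affineMap P.A P.b)^[n] x := by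
      intro n
      induction n with
      | zero => exact hs
      | succ n ih => rw [Function.iterate_succ_apply', ← ih]; exact (h n).1
    rw [← this]
    exact (h n).2
  · intro h
    refine ⟨{x}, ?_, rfl⟩
    intro y hy
    rw [Set.mem_singleton_iff.1 hy]
    exact ⟨fun n => (affineMap P.A P.b)^[n] x, rfl,
      fun i => ⟨Function.iterate_succ_apply' _ _ _, h i⟩⟩

end Affine

/-! ### Formulas for iterated preimages -/

namespace PForm

/-- Truth of a formula depends only on the values of its free variables. -/
theorem realize_congr {φ : PForm} {v w : ℕ → ℤ} (h : ∀ i ∈ φ.freeVars, v i = w i) :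
    φ.Realize v ↔ φ.Realize w := by
  induction φ generalizing v w with
  | atom c a =>
    have : ∑ i ∈ Finset.range a.length, a.getD i 0 * v i =
        ∑ i ∈ Finset.range a.length, a.getD i 0 * w i := by
      refine Finset.sum_congr rfl fun i hi => ?_
      by_cases h0 : a.getD i 0 = 0
      · rw [h0, zero_mul, zero_mul]
      · rw [h i (Finset.mem_filter.2 ⟨hi, h0⟩)]
    rw [Realize, Realize, this]
  | not φ ih => exact Iff.not (ih h)
  | and φ ψ ih₁ ih₂ =>
    exact and_congr (ih₁ fun i hi => h i (Finset.mem_union_left _ hi))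
      (ih₂ fun i hi => h i (Finset.mem_union_right _ hi))
  | ex i φ ih =>
    refine exists_congr fun z => ih fun j hj => ?_
    by_cases hji : j = i
    · simp [hji]
    · simp only [Function.update_of_ne hji]
      exact h j (Finset.mem_erase.2 ⟨hji, hj⟩)

/-- `φ` says that the first `N` variables satisfy `P`, whatever the values of the others. -/
def Expresses {N : ℕ} (φ : PForm) (P : (Fin N → ℤ) → Prop) : Prop :=
  ∀ v, φ.Realize v ↔ P fun i => v i

theorem expresses_sat {N : ℕ} {φ : PForm} (h : φ.freeVars ⊆ Finset.range N) :
    φ.Expresses (φ.Sat (N := N)) := fun v =>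
  realize_congr fun i hi => by
    have := Finset.mem_range.1 (h hi)
    simp [extend, this]

/-- Existential quantification over the variables in a list. -/
def exs (l : List ℕ) (φ : PForm) : PForm := l.foldr ex φ

theorem realize_exs {l : List ℕ} {φ : PForm} {v : ℕ → ℤ} :
    (exs l φ).Realize v ↔ ∃ w, (∀ i ∉ l, w i = v i) ∧ φ.Realize w := by
  induction l generalizing v with
  | nil =>
    refine ⟨fun h => ⟨v, fun _ _ => rfl, h⟩, ?_⟩
    rintro ⟨w, hw, h⟩
    rwa [← show w = v from funext fun i => hw i (by simp)]
  | cons j l ih =>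
    change (∃ z, (exs l φ).Realize (Function.update v j z)) ↔ _
    simp only [ih]
    constructor
    · rintro ⟨z, w, hw, h⟩
      refine ⟨w, fun i hi => ?_, h⟩
      rw [List.mem_cons, not_or] at hi
      rw [hw i hi.2, Function.update_of_ne hi.1]
    · rintro ⟨w, hw, h⟩
      refine ⟨w j, w, fun i hi => ?_, h⟩
      by_cases hij : i = j
      · simp [hij]
      · rw [Function.update_of_ne hij, hw i (by simp [hij, hi])]

theorem freeVars_exs (l : List ℕ) (φ : PForm) : (exs l φ).freeVars = φ.freeVars \ l.toFinset := by
  induction l with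
  | nil => simp [exs]
  | cons j l ih =>
    change (exs l φ).freeVars.erase j = _
    rw [ih, List.toFinset_cons, Finset.sdiff_insert]

/-- The coefficient list, with `w` entries, of `-x m + ∑ j, h j * x j`. -/
def defRow (w m : ℕ) (h : ℕ → ℤ) : List ℤ :=
  (List.range w).map fun j => bif j == m then -1 else h j

/-- The formula `φ` with `x m` evaluated as `c + ∑ j < w, h j * x j`, where `h m = 0`. -/
def letVar (w m : ℕ) (c : ℤ) (h : ℕ → ℤ) (φ : PForm) : PForm :=
  ex m (and (and (atom c (defRow w m h)) (atom (-c) ((defRow w m h).map fun a => -a))) φ)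

theorem sum_range_map_getD (w : ℕ) (f : ℕ → ℤ) (v : ℕ → ℤ) :
    ∑ i ∈ Finset.range ((List.range w).map f).length, ((List.range w).map f).getD i 0 * v i =
      ∑ i ∈ Finset.range w, f i * v i := by
  rw [List.length_map, List.length_range]
  refine Finset.sum_congr rfl fun i hi => ?_
  simp [List.getD, Finset.mem_range.1 hi]

theorem realize_letVar {w m : ℕ} (c : ℤ) {h : ℕ → ℤ} (hm : m < w) (h0 : h m = 0) (φ : PForm)
    (v : ℕ → ℤ) : (letVar w m c h φ).Realize v ↔
      φ.Realize (Function.update v m (c + ∑ j ∈ Finset.range w, h j * v j)) := by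
  have key : ∀ z, ∑ j ∈ Finset.range w, (bif j == m then -1 else h j) * Function.update v m z j =
      ∑ j ∈ Finset.range w, h j * v j - z := by
    intro z
    have hm' := Finset.mem_range.2 hm
    rw [← Finset.add_sum_erase _ _ hm', ← Finset.add_sum_erase _ (fun j => h j * v j) hm']
    have : ∀ j ∈ (Finset.range w).erase m,
        (bif j == m then -1 else h j) * Function.update v m z j = h j * v j := by
      intro j hj
      have hj := Finset.ne_of_mem_erase hj
      rw [beq_false_of_ne hj, cond_false, Function.update_of_ne hj]
    rw [Finset.sum_congr rfl this]
    simp [h0]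
    ring
  have neg : (defRow w m h).map (fun a => -a) =
      (List.range w).map fun j => -(bif j == m then -1 else h j) := by
    simp [defRow]
  rw [letVar, neg, defRow]
  simp only [Realize, sum_range_map_getD, neg_mul, Finset.sum_neg_distrib, key]
  constructor
  · rintro ⟨z, ⟨h₁, h₂⟩, hz⟩
    rwa [show c + ∑ j ∈ Finset.range w, h j * v j = z by linarith]
  · intro hφ
    exact ⟨_, ⟨by linarith, by linarith⟩, hφ⟩

theorem freeVars_letVar {w m : ℕ} {c : ℤ} {h : ℕ → ℤ} {φ : PForm}
    (hφ : φ.freeVars ⊆ Finset.range w) : (letVar w m c h φ).freeVars ⊆ Finset.range w := by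
  refine (Finset.erase_subset _ _).trans (Finset.union_subset (Finset.union_subset ?_ ?_) hφ)
  · exact (Finset.filter_subset _ _).trans (by simp [defRow])
  · exact (Finset.filter_subset _ _).trans (by simp [defRow])

/-- The formula `φ` with `x (o + i)` evaluated as `c i + ∑ j < w, h i j * x j` for all `i < n`. -/
def letBlock (w o n : ℕ) (c : ℕ → ℤ) (h : ℕ → ℕ → ℤ) (φ : PForm) : PForm :=
  (List.range n).foldr (fun i ψ => letVar w (o + i) (c i) (h i) ψ) φ

/-- The assignments of a block may be carried out one by one, since none of them reads a variable of
the block. -/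
theorem realize_letBlock {w o n : ℕ} (c : ℕ → ℤ) {h : ℕ → ℕ → ℤ} (hw : o + n ≤ w)
    (h0 : ∀ i < n, ∀ j, o ≤ j → j < o + n → h i j = 0) (φ : PForm) (v : ℕ → ℤ) :
    (letBlock w o n c h φ).Realize v ↔ φ.Realize fun j =>
      if o ≤ j ∧ j < o + n then c (j - o) + ∑ l ∈ Finset.range w, h (j - o) l * v l else v j := by
  suffices H : ∀ k ≤ n, ∀ ψ : PForm, (letBlock w o k c h ψ).Realize v ↔ ψ.Realize fun j =>
      if o ≤ j ∧ j < o + k then c (j - o) + ∑ l ∈ Finset.range w, h (j - o) l * v l else v j from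
    H n le_rfl φ
  intro k
  induction k with
  | zero =>
    intro _ ψ
    have : (fun j => if o ≤ j ∧ j < o + 0 then
        c (j - o) + ∑ l ∈ Finset.range w, h (j - o) l * v l else v j) = v :=
      funext fun j => if_neg (by omega)
    rw [this]
    rfl
  | succ k ih =>
    intro hk ψ
    have e : letBlock w o (k + 1) c h ψ = letBlock w o k c h (letVar w (o + k) (c k) (h k) ψ) := by
      simp [letBlock, List.range_succ]
    rw [e, ih (by omega), realize_letVar _ (by omega) (h0 k hk _ (by omega) (by omega))]
    refine Eq.to_iff (congrArg _ (funext fun j => ?_))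
    by_cases hj : j = o + k
    · subst hj
      rw [Function.update_self, if_pos (by omega), Nat.add_sub_cancel_left]
      congr 1
      refine Finset.sum_congr rfl fun l _ => ?_
      split_ifs with hl
      · rw [h0 k hk l hl.1 (by omega), zero_mul, zero_mul]
      · rfl
    · rw [Function.update_of_ne hj]
      refine if_congr ?_ rfl rfl
      omega

theorem freeVars_letBlock {w o n : ℕ} {c : ℕ → ℤ} {h : ℕ → ℕ → ℤ} {φ : PForm}
    (hφ : φ.freeVars ⊆ Finset.range w) : (letBlock w o n c h φ).freeVars ⊆ Finset.range w := by
  unfold letBlock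
  induction List.range n with
  | nil => exact hφ
  | cons i l ih => exact freeVars_letVar ih

/-- The formula `φ` with the first `N` variables evaluated simultaneously as
`x i := bs i + ∑ j, rows i j * x j`. The variables `x N, …, x (2 N - 1)` hold the new values while
the old ones are in use; `x (2 N)` may serve as a parameter. -/
def assign (N : ℕ) (rows : List (List ℤ)) (bs : List ℤ) (φ : PForm) : PForm :=
  letBlock (2 * N + 1) N N (fun i => bs.getD i 0) (fun i j => (rows.getD i []).getD j 0)
    (letBlock (2 * N + 1) 0 N (fun _ => 0) (fun i j => bif j == N + i then 1 else 0) φ)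

theorem realize_assign {N : ℕ} {rows : List (List ℤ)} (bs : List ℤ) {φ : PForm}
    {P : (Fin N → ℤ) → Prop} (hφ : φ.Expresses P)
    (h0 : ∀ i < N, ∀ j, N ≤ j → j < N + N → (rows.getD i []).getD j 0 = 0) (v : ℕ → ℤ) :
    (assign N rows bs φ).Realize v ↔ P fun i : Fin N =>
      bs.getD i 0 + ∑ j ∈ Finset.range (2 * N + 1), (rows.getD i []).getD j 0 * v j := by
  rw [assign, realize_letBlock _ (by omega) h0, realize_letBlock _ (by omega), hφ]
  · refine Eq.to_iff (congrArg _ (funext fun i => ?_))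
    have hi := i.2
    rw [if_pos (by omega), zero_add, Nat.sub_zero, Finset.sum_eq_single (N + (i : ℕ))]
    · simp
    · intro j _ hj
      rw [beq_false_of_ne hj, cond_false, zero_mul]
    · intro h
      exact absurd (Finset.mem_range.2 (by omega)) h
  · intro i _ j _ hj
    rw [beq_false_of_ne (by omega), cond_false]

theorem freeVars_assign {N : ℕ} {rows : List (List ℤ)} {bs : List ℤ} {φ : PForm}
    (hφ : φ.freeVars ⊆ Finset.range (2 * N + 1)) :
    (assign N rows bs φ).freeVars ⊆ Finset.range (2 * N + 1) :=
  freeVars_letBlock (freeVars_letBlock hφ)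

/-- The formula saying of a vector that its first `n` iterates under `x ↦ rows x + bs` satisfy
`φ`, and the next one satisfies `ψ`. -/
def along (N : ℕ) (rows : List (List ℤ)) (bs : List ℤ) (φ : PForm) (n : ℕ) (ψ : PForm) : PForm :=
  (fun χ => and φ (assign N rows bs χ))^[n] ψ

theorem freeVars_along {N : ℕ} {rows : List (List ℤ)} {bs : List ℤ} {φ ψ : PForm} (n : ℕ)
    (hφ : φ.freeVars ⊆ Finset.range (2 * N + 1)) (hψ : ψ.freeVars ⊆ Finset.range (2 * N + 1)) :
    (along N rows bs φ n ψ).freeVars ⊆ Finset.range (2 * N + 1) := by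
  induction n with
  | zero => exact hψ
  | succ n ih =>
    rw [along, Function.iterate_succ_apply']
    exact Finset.union_subset hφ (freeVars_assign ih)

theorem getD_ofFn {β : Type*} {N : ℕ} (f : Fin N → β) (i : ℕ) (d : β) :
    (List.ofFn f).getD i d = if h : i < N then f ⟨i, h⟩ else d := by
  split_ifs with h <;> simp [List.getD, h]

section

variable {N : ℕ} (P : AffinePresentation N)

theorem getD_rows (i j : ℕ) : (P.code.2.1.getD i []).getD j 0 =
    if h : i < N ∧ j < N then P.A ⟨i, h.1⟩ ⟨j, h.2⟩ else 0 := by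
  rw [AffinePresentation.code, getD_ofFn]
  by_cases hi : i < N
  · simp only [hi, dif_pos, true_and, getD_ofFn]
  · simp [hi]

theorem expresses_along {φ ψ : PForm} {Q R : (Fin N → ℤ) → Prop} (hφ : φ.Expresses Q)
    (hψ : ψ.Expresses R) (n : ℕ) :
    (along N P.code.2.1 P.code.2.2.1 φ n ψ).Expresses fun x =>
      (∀ r < n, Q ((affineMap P.A P.b)^[r] x)) ∧ R ((affineMap P.A P.b)^[n] x) := by
  induction n with
  | zero => intro v; simpa [along] using hψ v
  | succ n ih =>
    intro v
    rw [along, Function.iterate_succ_apply']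
    change φ.Realize v ∧ (assign N P.code.2.1 P.code.2.2.1
      (along N P.code.2.1 P.code.2.2.1 φ n ψ)).Realize v ↔ _
    rw [hφ v, realize_assign _ ih]
    · have e : (fun i : Fin N => P.code.2.2.1.getD i 0 + ∑ j ∈ Finset.range (2 * N + 1),
          (P.code.2.1.getD i []).getD j 0 * v j) = affineMap P.A P.b fun i => v i := by
        funext i
        have h₁ : P.code.2.2.1.getD i 0 = P.b i := by
          rw [AffinePresentation.code, getD_ofFn, dif_pos i.2]
        have h₂ : ∑ j ∈ Finset.range (2 * N + 1), (P.code.2.1.getD i []).getD j 0 * v j =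
            ∑ j ∈ Finset.range N, (P.code.2.1.getD i []).getD j 0 * v j := by
          refine (Finset.sum_subset (Finset.range_mono (by omega)) fun j _ hj => ?_).symm
          rw [Finset.mem_range] at hj
          rw [getD_rows, dif_neg (fun h => hj h.2), zero_mul]
        rw [h₁, h₂, Finset.sum_range, affineMap, Pi.add_apply, add_comm]
        congr 1
        refine Finset.sum_congr rfl fun j _ => ?_
        rw [getD_rows, dif_pos ⟨i.2, j.2⟩]
      rw [e]
      simp only [← Function.iterate_succ_apply]
      rw [← and_assoc]
      refine and_congr_left fun _ => ?_
      constructor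
      · rintro ⟨h0, h⟩ (_ | r) hr
        · exact h0
        · exact h r (by omega)
      · exact fun h => ⟨h 0 (by omega), fun r hr => h (r + 1) (by omega)⟩
    · intro i _ j hj _
      rw [getD_rows, dif_neg (by omega)]

/-- The rows of the assignment `x i := x i + cs i * x (2 N)`. -/
def translationRows (N : ℕ) (cs : List ℤ) : List (List ℤ) :=
  (List.range N).map fun i => (List.range (2 * N + 1)).map fun j =>
    bif j == i then 1 else bif j == 2 * N then cs.getD i 0 else 0

/-- The formula saying of a vector `x` that `x + k cs` satisfies `φ` for all `k ≥ 0`. -/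
def allTranslates (N : ℕ) (cs : List ℤ) (φ : PForm) : PForm :=
  not (ex (2 * N) (and
    (atom 0 ((List.range (2 * N + 1)).map fun j => bif j == 2 * N then -1 else 0))
    (not (assign N (translationRows N cs) [] φ))))

theorem freeVars_allTranslates {N : ℕ} {cs : List ℤ} {φ : PForm}
    (hφ : φ.freeVars ⊆ Finset.range (2 * N + 1)) :
    (allTranslates N cs φ).freeVars ⊆ Finset.range (2 * N + 1) := by
  refine (Finset.erase_subset _ _).trans (Finset.union_subset ?_ (freeVars_assign hφ))
  exact (Finset.filter_subset _ _).trans (by simp)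

theorem getD_translationRows {N i j : ℕ} (cs : List ℤ) (hi : i < N) (hj : j < 2 * N + 1) :
    ((translationRows N cs).getD i []).getD j 0 =
      bif j == i then 1 else bif j == 2 * N then cs.getD i 0 else 0 := by
  simp [translationRows, List.getD, hi, hj]

theorem expresses_allTranslates {N : ℕ} (cs : List ℤ) {φ : PForm} {Q : (Fin N → ℤ) → Prop}
    (hφ : φ.Expresses Q) : (allTranslates N cs φ).Expresses fun x =>
      ∀ k : ℕ, Q (x + (k : ℤ) • fun i : Fin N => cs.getD i 0) := by
  intro v
  have hsum : ∀ z : ℤ, ∑ j ∈ Finset.range (2 * N + 1),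
      (bif j == 2 * N then (-1 : ℤ) else 0) * Function.update v (2 * N) z j = -z := by
    intro z
    rw [Finset.sum_eq_single (2 * N)]
    · simp
    · intro j _ hj
      rw [beq_false_of_ne hj, cond_false, zero_mul]
    · simp
  have hasg : ∀ z : ℤ, (assign N (translationRows N cs) [] φ).Realize
      (Function.update v (2 * N) z) ↔
        Q ((fun i : Fin N => v i) + z • fun i : Fin N => cs.getD i 0) := by
    intro z
    rw [realize_assign _ hφ]
    · refine Eq.to_iff (congrArg _ (funext fun i => ?_))
      have hi := i.2
      rw [Finset.sum_congr rfl fun j hj => by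
          rw [getD_translationRows cs hi (Finset.mem_range.1 hj)],
        Finset.sum_eq_add (i : ℕ) (2 * N) (by omega)]
      · rw [beq_false_of_ne (show 2 * N ≠ (i : ℕ) by omega), Function.update_self,
          Function.update_of_ne (by omega)]
        simp [mul_comm z]
      · rintro j - ⟨h₁, h₂⟩
        rw [beq_false_of_ne h₁, beq_false_of_ne h₂, cond_false, cond_false, zero_mul]
      · exact fun h => absurd (Finset.mem_range.2 (by omega)) h
      · exact fun h => absurd (Finset.mem_range.2 (by omega)) h
    · intro i hi j hj hj'
      rw [getD_translationRows cs hi (by omega), beq_false_of_ne (show j ≠ i by omega),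
        beq_false_of_ne (show j ≠ 2 * N by omega), cond_false, cond_false]
  simp only [allTranslates, Realize, sum_range_map_getD, hsum, hasg]
  push Not
  constructor
  · intro h k
    exact h k (by omega)
  · intro h z hz
    have := h z.toNat
    rwa [Int.toNat_of_nonneg (by omega)] at this

/-- One step of `x ↦ rows x + bs` on lists of integers. -/
def listStep (N : ℕ) (rows : List (List ℤ)) (bs : List ℤ) (x : List ℤ) : List ℤ :=
  (List.range N).map fun i =>
    (List.range N).foldr (fun j r => (rows.getD i []).getD j 0 * x.getD j 0 + r) 0 + bs.getD i 0

theorem getD_listStep_iterate (n : ℕ) (i : Fin N) :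
    ((listStep N P.code.2.1 P.code.2.2.1)^[n] []).getD i 0 = (affineMap P.A P.b)^[n] 0 i := by
  induction n generalizing i with
  | zero => simp
  | succ n ih =>
    rw [Function.iterate_succ_apply', Function.iterate_succ_apply']
    set x := (listStep N P.code.2.1 P.code.2.2.1)^[n] []
    have hfold : ∀ (f : ℕ → ℤ) (M : ℕ), (List.range M).foldr (fun j r => f j + r) 0 =
        ∑ j ∈ Finset.range M, f j := by
      intro f M
      rw [Finset.sum_range, ← List.sum_ofFn, ← List.foldr_map, List.sum_eq_foldr]
      congr 1
      exact List.ext_getElem (by simp) (by simp)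
    have hb : P.code.2.2.1.getD i 0 = P.b i := by
      rw [AffinePresentation.code, getD_ofFn, dif_pos i.2]
    have e : (listStep N P.code.2.1 P.code.2.2.1 x).getD i 0 =
        (List.range N).foldr (fun j r => (P.code.2.1.getD i []).getD j 0 * x.getD j 0 + r) 0 +
          P.code.2.2.1.getD i 0 := by
      simp [listStep, List.getD, i.2]
    rw [e, hfold, hb, Finset.sum_range, affineMap, Pi.add_apply]
    congr 1
    refine Finset.sum_congr rfl fun j _ => ?_
    rw [getD_rows, dif_pos ⟨i.2, j.2⟩, ih]

/-- The translation vector of `q` steps of `x ↦ rows x + bs` after `p` steps. -/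
def drift (N : ℕ) (rows : List (List ℤ)) (bs : List ℤ) (p q : ℕ) : List ℤ :=
  (List.range N).map fun i => ((listStep N rows bs)^[p + q] []).getD i 0 -
    ((listStep N rows bs)^[p] []).getD i 0

/-- The formula for the weakest non-termination precondition. The outermost quantifiers range over
the auxiliary variables, on which the formula depends only syntactically. -/
def wntFormula (N : ℕ) (rows : List (List ℤ)) (bs : List ℤ) (φ : PForm) : PForm :=
  exs ((List.range (N + 1)).map fun i => N + i)
    (along N rows bs φ N
      (allTranslates N (drift N rows bs N (2 * N).factorial)
        (along N rows bs φ (2 * N).factorial (atom 0 []))))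

theorem wntFormula_defines (hP : P.FiniteMonoid) :
    (wntFormula N P.code.2.1 P.code.2.2.1 P.code.2.2.2).Defines (wnt P.rel) := by
  have hg := P.guard_freeVars
  have hg' : P.guard.freeVars ⊆ Finset.range (2 * N + 1) :=
    hg.trans (Finset.range_mono (by omega))
  have hdrift : (fun i : Fin N => (drift N P.code.2.1 P.code.2.2.1 N (2 * N).factorial).getD i 0) =
      (affineMap P.A P.b)^[N + (2 * N).factorial] 0 - (affineMap P.A P.b)^[N] 0 := by
    funext i
    rw [Pi.sub_apply, ← getD_listStep_iterate, ← getD_listStep_iterate]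
    simp [drift, List.getD, i.2]
  constructor
  · rw [wntFormula, freeVars_exs]
    intro i hi
    rw [Finset.mem_sdiff, List.mem_toFinset, List.mem_map] at hi
    have h₁ := Finset.mem_range.1 (freeVars_along N hg' (freeVars_allTranslates
      (freeVars_along _ hg' (by simp [freeVars]))) hi.1)
    by_contra h
    rw [Finset.mem_range] at h
    exact hi.2 ⟨i - N, List.mem_range.2 (by omega), by omega⟩
  · intro x
    have htrue : (atom 0 []).Expresses fun _ : Fin N → ℤ => True := fun v => by simp [Realize]
    have hex := expresses_along P (expresses_sat hg) (expresses_allTranslates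
      (drift N P.code.2.1 P.code.2.2.1 N (2 * N).factorial)
      (expresses_along P (expresses_sat hg) htrue (2 * N).factorial)) N
    rw [mem_wnt_iff, forall_iterate_iff (Nat.factorial_pos (2 * N))
      (Matrix.pow_add_factorial_eq_of_finite_powers P.A hP), Sat, wntFormula, realize_exs]
    rw [hdrift] at hex
    have hx : ∀ w : ℕ → ℤ, (∀ i ∉ (List.range (N + 1)).map fun i => N + i, w i = extend x i) →
        (fun i : Fin N => w i) = x := by
      intro w hw
      funext i
      have hi := i.2
      rw [hw i (by simp; omega)]
      simp [extend]
    constructor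
    · intro h
      refine ⟨extend x, fun _ _ => rfl, (hex _).2 ?_⟩
      rw [hx _ fun _ _ => rfl]
      simpa using h
    · rintro ⟨w, hw, h⟩
      have h := (hex _).1 h
      rw [hx _ hw] at h
      simpa using h

end

section Primrec

variable {α : Type*} [Primcodable α]

@[fun_prop]
theorem primrec_factorial {f : α → ℕ} (hf : Primrec f) : Primrec fun a => (f a).factorial := by
  have : Primrec fun a => (List.range (f a)).foldr (fun i r => r * (i + 1)) 1 := by fun_prop
  refine this.of_eq fun a => ?_
  have H : ∀ n c, (List.range n).foldr (fun i r => r * (i + 1)) c = n.factorial * c := by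
    intro n
    induction n with
    | zero => simp
    | succ n ih =>
      intro c
      rw [List.range_succ, List.foldr_append, ih, Nat.factorial_succ]
      simp only [List.foldr_cons, List.foldr_nil]
      ring
  rw [H, mul_one]

@[fun_prop]
theorem primrec_exs {f : α → List ℕ} {g : α → PForm} (hf : Primrec f) (hg : Primrec g) :
    Primrec fun a => exs (f a) (g a) := by
  unfold exs
  fun_prop

@[fun_prop]
theorem primrec_letVar {w m : α → ℕ} {c : α → ℤ} {h : α → ℕ → ℤ} {φ : α → PForm}
    (hw : Primrec w) (hm : Primrec m) (hc : Primrec c) (hh : Primrec fun p : α × ℕ => h p.1 p.2)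
    (hφ : Primrec φ) : Primrec fun a => letVar (w a) (m a) (c a) (h a) (φ a) := by
  unfold letVar defRow
  fun_prop

@[fun_prop]
theorem primrec_letBlock {w o n : α → ℕ} {c : α → ℕ → ℤ} {h : α → ℕ → ℕ → ℤ} {φ : α → PForm}
    (hw : Primrec w) (ho : Primrec o) (hn : Primrec n) (hc : Primrec fun p : α × ℕ => c p.1 p.2)
    (hh : Primrec fun p : α × ℕ × ℕ => h p.1 p.2.1 p.2.2) (hφ : Primrec φ) :
    Primrec fun a => letBlock (w a) (o a) (n a) (c a) (h a) (φ a) := by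
  unfold letBlock
  have h₁ := hc.comp (g := fun p : α × ℕ × PForm => (p.1, p.2.1)) (by fun_prop)
  have h₂ := hh.comp (g := fun p : (α × ℕ × PForm) × ℕ => (p.1.1, p.1.2.1, p.2)) (by fun_prop)
  fun_prop

@[fun_prop]
theorem primrec_assign {N : α → ℕ} {rows : α → List (List ℤ)} {bs : α → List ℤ} {φ : α → PForm}
    (hN : Primrec N) (hrows : Primrec rows) (hbs : Primrec bs) (hφ : Primrec φ) :
    Primrec fun a => assign (N a) (rows a) (bs a) (φ a) := by
  unfold assign
  fun_prop

@[fun_prop]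
theorem primrec_along {N n : α → ℕ} {rows : α → List (List ℤ)} {bs : α → List ℤ}
    {φ ψ : α → PForm} (hN : Primrec N) (hrows : Primrec rows) (hbs : Primrec bs)
    (hφ : Primrec φ) (hn : Primrec n) (hψ : Primrec ψ) :
    Primrec fun a => along (N a) (rows a) (bs a) (φ a) (n a) (ψ a) := by
  unfold along
  fun_prop

@[fun_prop]
theorem primrec_allTranslates {N : α → ℕ} {cs : α → List ℤ} {φ : α → PForm}
    (hN : Primrec N) (hcs : Primrec cs) (hφ : Primrec φ) :
    Primrec fun a => allTranslates (N a) (cs a) (φ a) := by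
  unfold allTranslates translationRows
  fun_prop

@[fun_prop]
theorem primrec_drift {N p q : α → ℕ} {rows : α → List (List ℤ)} {bs : α → List ℤ}
    (hN : Primrec N) (hrows : Primrec rows) (hbs : Primrec bs) (hp : Primrec p)
    (hq : Primrec q) : Primrec fun a => drift (N a) (rows a) (bs a) (p a) (q a) := by
  unfold drift listStep
  fun_prop

@[fun_prop]
theorem primrec_wntFormula {N : α → ℕ} {rows : α → List (List ℤ)} {bs : α → List ℤ}
    {φ : α → PForm} (hN : Primrec N) (hrows : Primrec rows) (hbs : Primrec bs)
    (hφ : Primrec φ) : Primrec fun a => wntFormula (N a) (rows a) (bs a) (φ a) := by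
  unfold wntFormula
  fun_prop

end Primrec

end PForm

/-! ### The weakest non-termination precondition and termination -/

theorem terminating_iff {N : ℕ} (P : AffinePresentation N) :
    Terminating P.rel ↔ wnt P.rel = ∅ := by
  rw [Terminating, Set.eq_empty_iff_forall_notMem, not_exists]
  constructor
  · rintro h x ⟨S, hS, hx⟩
    obtain ⟨s, -, hs⟩ := hS x hx
    exact h s hs
  · intro h s hs
    refine h (s 0) ⟨{s 0}, fun y hy => ⟨s, (Set.mem_singleton_iff.1 hy).symm, hs⟩, rfl⟩

/-- A set of integer vectors is nonempty iff the existential closure of a defining formula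
holds. -/
theorem PForm.Defines.nonempty_iff {N : ℕ} {φ : PForm} {S : Set (Fin N → ℤ)} (h : φ.Defines S) :
    (exs (List.range N) φ).Realize 0 ↔ S.Nonempty := by
  rw [realize_exs]
  constructor
  · rintro ⟨w, hw, hφ⟩
    refine ⟨fun i => w i, (h.2 _).2 ?_⟩
    have : extend (fun i : Fin N => w i) = w := by
      funext i
      by_cases hi : i < N
      · simp [extend, hi]
      · rw [hw i (by simpa using hi)]
        simp [extend, hi]
    rwa [Sat, this]
  · rintro ⟨x, hx⟩
    refine ⟨extend x, fun i hi => ?_, (h.2 x).1 hx⟩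
    rw [extend, dif_neg (by simpa using hi), Pi.zero_apply]

theorem mainTheorem4 :
    (∀ (N : ℕ) (P : AffinePresentation N), P.FiniteMonoid → PresburgerDefinable (wnt P.rel)) ∧
    (∃ f : ℕ × List (List ℤ) × List ℤ × PForm → PForm, Computable f ∧
      ∀ (N : ℕ) (P : AffinePresentation N), P.FiniteMonoid → (f P.code).Defines (wnt P.rel)) ∧
    (∃ g : ℕ × List (List ℤ) × List ℤ × PForm → Bool, Computable g ∧
      ∀ (N : ℕ) (P : AffinePresentation N), P.FiniteMonoid →
        (g P.code = true ↔ Terminating P.rel)) := by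
  have hf : Primrec fun p : ℕ × List (List ℤ) × List ℤ × PForm =>
      PForm.wntFormula p.1 p.2.1 p.2.2.1 p.2.2.2 := by fun_prop
  have hg : Primrec fun p : ℕ × List (List ℤ) × List ℤ × PForm => !QE.decideZero
      (PForm.exs (List.range p.1) (PForm.wntFormula p.1 p.2.1 p.2.2.1 p.2.2.2)) := by fun_prop
  refine ⟨fun N P hP => ⟨_, PForm.wntFormula_defines P hP⟩,
    ⟨_, hf.to_comp, fun N P hP => PForm.wntFormula_defines P hP⟩,
    ⟨_, hg.to_comp, fun N P hP => ?_⟩⟩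
  have h := (PForm.wntFormula_defines P hP).nonempty_iff
  rw [← QE.decideZero_iff] at h
  rw [terminating_iff, ← Set.not_nonempty_iff_eq_empty, ← h]
  simp only [Bool.not_eq_true', Bool.not_eq_true]
  rfl
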